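/- **Setting.** The non-recursive Dependency Core Calculus (DCC) over the lattice $\{L,H\}$, $L\sqsubset H$, has types $\tau ::= \mathbb B\mid\tau\to\tau\mid\tau\times\tau\mid T_\ell(\tau)$ and expressions $e ::= x\mid\lambda x.e\mid e\,e\mid \mathsf{tt}\mid\mathsf{ff}\mid \mathsf{case}\,e\,\mathsf{of}\,\mathsf{tt}\mapsto e;\mathsf{ff}\mapsto e\mid\langle e,e\rangle\mid\pi_1(e)\mid\pi_2(e)\mid\eta_\ell(e)\mid\mathsf{bind}(e,x.e)$. Typing is that of the simply typed $\lambda$-calculus (abstractions carry no type), together with: $\Gamma\vdash\eta_\ell(e):T_\ell(\tau)$ if $\Gamma\vdash e:\tau$; and $\Gamma\vdash\mathsf{bind}(e_1,x.e_2):\tau_2$ if $\Gamma\vdash e_1:T_\ell(\tau_1)$, $\Gamma,x:\tau_1\vdash e_2:\tau_2$ and $\tau_2$ is protected at $\ell$. Protection at $\ell$ is the least relation such that $T_{\ell'}(\tau)$ is protected if $\ell\sqsubseteq\ell'$ or $\tau$ is protected, $\tau_1\times\tau_2$ is protected if both $\tau_i$ are, and $\tau_1\to\tau_2$ is protected if $\tau_2$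 is. Relational Higher-Order Logic (RHOL) derives judgements $\Gamma\mid\Psi\vdash t_1:\sigma_1\sim t_2:\sigma_2\mid\phi$ about pairs of terms of a Curry-style PCF with booleans, naturals, lists, products and guarded recursion, where $\Psi$ is a set of assertions of higher-order logic (HOL) over $\Gamma$ and $\phi$ is an assertion in which $\mathbf r_1,\mathbf r_2$ stand for $t_1,t_2$. HOL is taken over an arbitrary signature of basic predicates with axioms. **Translation.** The erasure of types is $|\mathbb B|=\mathbb B$, $|\tau_1\to\tau_2|=|\tau_1|\to|\tau_2|$, $|\tau_1\times\tau_2|=|\tau_1|\times|\tau_2|$, $|T_\ell(\tau)|=|\tau|$. The erasure of expressions commutes with all constructs except $|\eta_\ell(e)|=|e|$ and $|\mathsf{bind}(e_1,x.e_2)|=(\lambda x.|e_2|)\,|e_1|$. For $i=1,2$, $|e|_i$ is $|e|$ with every variable $x$ replaced by $x_i$, and $|\Gamma|$ declares $x_1:|\tau|,\ x_2:|\tau|$ for each $x:\tau$ in $\Gamma$. For an observer level $a\in\{L,H\}$ the assertions $\lfloor\tau\rfloor_a(x,y)$ are - $\lfloor\mathbb B\rfloor_a(x,y) = (x=\mathsf{tt}\wedge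 y=\mathsf{tt})\vee(x=\mathsf{ff}\wedge y=\mathsf{ff})$, - $\lfloor\tau_1\to\tau_2\rfloor_a(x,y)=\forall v,w.\ \lfloor\tau_1\rfloor_a(v,w)\Rightarrow\lfloor\tau_2\rfloor_a(x\,v,y\,w)$, - $\lfloor\tau_1\times\tau_2\rfloor_a(x,y)=\lfloor\tau_1\rfloor_a(\pi_1x,\pi_1y)\wedge\lfloor\tau_2\rfloor_a(\pi_2x,\pi_2y)$, - $\lfloor T_\ell(\tau)\rfloor_a(x,y)=\lfloor\tau\rfloor_a(x,y)$ if $\ell\sqsubseteq a$, and $\top$ otherwise. $\lfloor\Gamma\rfloor_a$ is the set of the assertions $\lfloor\tau\rfloor_a(x_1,x_2)$ for $x:\tau$ in $\Gamma$. **Theorem (Soundness of the DCC embedding, and noninterference).** 1. If $\Gamma\vdash e:\tau$ in DCC, then for every $a\in\{L,H\}$ the judgement $$|\Gamma|\;\mid\;\lfloor\Gamma\rfloor_a\;\vdash\;|e|_1:|\tau|\;\sim\;|e|_2:|\tau|\;\mid\;\lfloor\tau\rfloor_a(\mathbf r_1,\mathbf r_2)$$ is derivable in RHOL. 2. If $\ell\not\sqsubseteq\ell'$,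 $x:T_\ell(\mathbb B)\vdash e:T_{\ell'}(\mathbb B)$ and $\vdash e_1:T_\ell(\mathbb B)$, $\vdash e_2:T_\ell(\mathbb B)$ in DCC, then $e[e_1/x]$ and $e[e_2/x]$ denote the same, uniquely determined, boolean in the set-theoretic model (in which $\mathbb B$ is the set of booleans, $\to$ and $\times$ are the full function space and the product, and $T_\ell(\tau)$ is interpreted as $\tau$). -/

import Mathlib

/-! ## The variant of PCF: simple types, terms in the style of Curry, reduction, typing

Binding is represented by de Bruijn indices: the variable `♯0` is the one bound (or declared) last,
so a context `x₁ : τ₁, …, xₙ : τₙ` is the list `[τₙ, …, τ₁]`. -/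

universe u

namespace PCF

inductive Ty : Type
  | bool : Ty
  | nat : Ty
  | list : Ty → Ty
  | prod : Ty → Ty → Ty
  | arr : Ty → Ty → Ty

/-- Terms. `lam t` binds one variable of `t`. `letrec t` is `letrec f x = t`; in `t` the argument `x`
is `♯0` and the function `f` is `♯1`. The branches of `caseNat`, `caseList` for `S` and `::` are
functions of the components of the constructor. -/
inductive Tm : Type
  | var : ℕ → Tm
  | pair : Tm → Tm → Tm
  | fst : Tm → Tm
  | snd : Tm → Tm
  | app : Tm → Tm → Tm
  | lam : Tm → Tm
  | tt : Tm
  | ff : Tm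
  | zero : Tm
  | nil : Tm
  | succ : Tm → Tm
  | cons : Tm → Tm → Tm
  | caseBool : Tm → Tm → Tm → Tm
  | caseNat : Tm → Tm → Tm → Tm
  | caseList : Tm → Tm → Tm → Tm
  | letrec : Tm → Tm

prefix:max "♯" => Tm.var

/-- The extension of a map on indices below one binder. -/
def liftRen (ξ : ℕ → ℕ) : ℕ → ℕ
  | 0 => 0
  | n + 1 => ξ n + 1

def Tm.rename : (ℕ → ℕ) → Tm → Tm
  | ξ, .var i => .var (ξ i)
  | ξ, .pair t s => .pair (t.rename ξ) (s.rename ξ)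
  | ξ, .fst t => .fst (t.rename ξ)
  | ξ, .snd t => .snd (t.rename ξ)
  | ξ, .app t s => .app (t.rename ξ) (s.rename ξ)
  | ξ, .lam t => .lam (t.rename (liftRen ξ))
  | _, .tt => .tt
  | _, .ff => .ff
  | _, .zero => .zero
  | _, .nil => .nil
  | ξ, .succ t => .succ (t.rename ξ)
  | ξ, .cons t s => .cons (t.rename ξ) (s.rename ξ)
  | ξ, .caseBool t s r => .caseBool (t.rename ξ) (s.rename ξ) (r.rename ξ)
  | ξ, .caseNat t s r => .caseNat (t.rename ξ) (s.rename ξ) (r.rename ξ)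
  | ξ, .caseList t s r => .caseList (t.rename ξ) (s.rename ξ) (r.rename ξ)
  | ξ, .letrec t => .letrec (t.rename (liftRen (liftRen ξ)))

/-- The extension of a substitution below one binder. -/
def lift (σ : ℕ → Tm) : ℕ → Tm
  | 0 => ♯0
  | n + 1 => (σ n).rename (· + 1)

/-- Simultaneous capture-avoiding substitution. -/
def Tm.subst : (ℕ → Tm) → Tm → Tm
  | σ, .var i => σ i
  | σ, .pair t s => .pair (t.subst σ) (s.subst σ)
  | σ, .fst t => .fst (t.subst σ)
  | σ, .snd t => .snd (t.subst σ)
  | σ, .app t s => .app (t.subst σ) (s.subst σ)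
  | σ, .lam t => .lam (t.subst (lift σ))
  | _, .tt => .tt
  | _, .ff => .ff
  | _, .zero => .zero
  | _, .nil => .nil
  | σ, .succ t => .succ (t.subst σ)
  | σ, .cons t s => .cons (t.subst σ) (s.subst σ)
  | σ, .caseBool t s r => .caseBool (t.subst σ) (s.subst σ) (r.subst σ)
  | σ, .caseNat t s r => .caseNat (t.subst σ) (s.subst σ) (r.subst σ)
  | σ, .caseList t s r => .caseList (t.subst σ) (s.subst σ) (r.subst σ)
  | σ, .letrec t => .letrec (t.subst (lift (lift σ)))

/-- `t ∷ σ` is the substitution `0 ↦ t`, `n + 1 ↦ σ n`. -/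
def scons (t : Tm) (σ : ℕ → Tm) : ℕ → Tm
  | 0 => t
  | n + 1 => σ n

infixr:60 " ∷ " => scons

/-- The weakening by `k` variables. So `t₀ ∷ … ∷ tₘ ∷ sh k` sends the last `m + 1` declared variables
to `t₀, …, tₘ` and skips `k` new variables for all the others. -/
def sh (k : ℕ) : ℕ → Tm := fun n => ♯(n + k)

/-- Head constructor `tt`, `ff`, `0`, `S`, `[]` or `::`. -/
inductive IsConstr : Tm → Prop
  | tt : IsConstr .tt
  | ff : IsConstr .ff
  | zero : IsConstr .zero
  | succ (t : Tm) : IsConstr (.succ t)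
  | nil : IsConstr .nil
  | cons (t s : Tm) : IsConstr (.cons t s)

/-- One step of `βιμ`-reduction, in any context. -/
inductive Step : Tm → Tm → Prop
  | beta (t s : Tm) : Step (.app (.lam t) s) (t.subst (s ∷ Tm.var))
  | fst (t s : Tm) : Step (.fst (.pair t s)) t
  | snd (t s : Tm) : Step (.snd (.pair t s)) s
  | caseTt (s r : Tm) : Step (.caseBool .tt s r) s
  | caseFf (s r : Tm) : Step (.caseBool .ff s r) r
  | caseZero (s r : Tm) : Step (.caseNat .zero s r) s
  | caseSucc (t s r : Tm) : Step (.caseNat (.succ t) s r) (.app r t)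
  | caseNil (s r : Tm) : Step (.caseList .nil s r) s
  | caseCons (h t s r : Tm) : Step (.caseList (.cons h t) s r) (.app (.app r h) t)
  | mu (t c : Tm) : IsConstr c → Step (.app (.letrec t) c) (t.subst (c ∷ .letrec t ∷ Tm.var))
  | pairL {t t' : Tm} (s : Tm) : Step t t' → Step (.pair t s) (.pair t' s)
  | pairR (t : Tm) {s s' : Tm} : Step s s' → Step (.pair t s) (.pair t s')
  | congFst {t t' : Tm} : Step t t' → Step (.fst t) (.fst t')
  | congSnd {t t' : Tm} : Step t t' → Step (.snd t) (.snd t')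
  | appL {t t' : Tm} (s : Tm) : Step t t' → Step (.app t s) (.app t' s)
  | appR (t : Tm) {s s' : Tm} : Step s s' → Step (.app t s) (.app t s')
  | congLam {t t' : Tm} : Step t t' → Step (.lam t) (.lam t')
  | congSucc {t t' : Tm} : Step t t' → Step (.succ t) (.succ t')
  | consL {t t' : Tm} (s : Tm) : Step t t' → Step (.cons t s) (.cons t' s)
  | consR (t : Tm) {s s' : Tm} : Step s s' → Step (.cons t s) (.cons t s')
  | caseBool₁ {t t' : Tm} (s r : Tm) : Step t t' → Step (.caseBool t s r) (.caseBool t' s r)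
  | caseBool₂ (t : Tm) {s s' : Tm} (r : Tm) :
      Step s s' → Step (.caseBool t s r) (.caseBool t s' r)
  | caseBool₃ (t s : Tm) {r r' : Tm} : Step r r' → Step (.caseBool t s r) (.caseBool t s r')
  | caseNat₁ {t t' : Tm} (s r : Tm) : Step t t' → Step (.caseNat t s r) (.caseNat t' s r)
  | caseNat₂ (t : Tm) {s s' : Tm} (r : Tm) : Step s s' → Step (.caseNat t s r) (.caseNat t s' r)
  | caseNat₃ (t s : Tm) {r r' : Tm} : Step r r' → Step (.caseNat t s r) (.caseNat t s r')
  | caseList₁ {t t' : Tm} (s r : Tm) : Step t t' → Step (.caseList t s r) (.caseList t' s r)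
  | caseList₂ (t : Tm) {s s' : Tm} (r : Tm) :
      Step s s' → Step (.caseList t s r) (.caseList t s' r)
  | caseList₃ (t s : Tm) {r r' : Tm} : Step r r' → Step (.caseList t s r) (.caseList t s r')
  | congLetrec {t t' : Tm} : Step t t' → Step (.letrec t) (.letrec t')

/-- `βιμ`-conversion. -/
def Conv : Tm → Tm → Prop := Relation.EqvGen Step

/-- `Guarded f x sm t`: in `t` the function variable `f` occurs only applied to a variable that is
structurally smaller than the variable `x`. The set `sm` holds the variables known to be smaller:
the predecessor, or the tail, that a case analysis of `x` or of a smaller variable yields. -/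
inductive Guarded : ℕ → ℕ → Set ℕ → Tm → Prop
  | var {f x : ℕ} {sm : Set ℕ} {i : ℕ} : i ≠ f → Guarded f x sm (.var i)
  | call {f x : ℕ} {sm : Set ℕ} {y : ℕ} : y ∈ sm → Guarded f x sm (.app (.var f) (.var y))
  | pair {f x : ℕ} {sm : Set ℕ} {t s : Tm} :
      Guarded f x sm t → Guarded f x sm s → Guarded f x sm (.pair t s)
  | fst {f x : ℕ} {sm : Set ℕ} {t : Tm} : Guarded f x sm t → Guarded f x sm (.fst t)
  | snd {f x : ℕ} {sm : Set ℕ} {t : Tm} : Guarded f x sm t → Guarded f x sm (.snd t)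
  | app {f x : ℕ} {sm : Set ℕ} {t s : Tm} :
      Guarded f x sm t → Guarded f x sm s → Guarded f x sm (.app t s)
  | lam {f x : ℕ} {sm : Set ℕ} {t : Tm} :
      Guarded (f + 1) (x + 1) ((· + 1) '' sm) t → Guarded f x sm (.lam t)
  | tt {f x : ℕ} {sm : Set ℕ} : Guarded f x sm .tt
  | ff {f x : ℕ} {sm : Set ℕ} : Guarded f x sm .ff
  | zero {f x : ℕ} {sm : Set ℕ} : Guarded f x sm .zero
  | nil {f x : ℕ} {sm : Set ℕ} : Guarded f x sm .nil
  | succ {f x : ℕ} {sm : Set ℕ} {t : Tm} : Guarded f x sm t → Guarded f x sm (.succ t)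
  | cons {f x : ℕ} {sm : Set ℕ} {t s : Tm} :
      Guarded f x sm t → Guarded f x sm s → Guarded f x sm (.cons t s)
  | caseBool {f x : ℕ} {sm : Set ℕ} {t s r : Tm} :
      Guarded f x sm t → Guarded f x sm s → Guarded f x sm r → Guarded f x sm (.caseBool t s r)
  | caseNat {f x : ℕ} {sm : Set ℕ} {t s r : Tm} :
      Guarded f x sm t → Guarded f x sm s → Guarded f x sm r → Guarded f x sm (.caseNat t s r)
  | caseList {f x : ℕ} {sm : Set ℕ} {t s r : Tm} :
      Guarded f x sm t → Guarded f x sm s → Guarded f x sm r → Guarded f x sm (.caseList t s r)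
  | destrNat {f x : ℕ} {sm : Set ℕ} {i : ℕ} {s r : Tm} :
      i ≠ f → i = x ∨ i ∈ sm → Guarded f x sm s →
      Guarded (f + 1) (x + 1) (insert 0 ((· + 1) '' sm)) r →
      Guarded f x sm (.caseNat (.var i) s (.lam r))
  | destrList {f x : ℕ} {sm : Set ℕ} {i : ℕ} {s r : Tm} :
      i ≠ f → i = x ∨ i ∈ sm → Guarded f x sm s →
      Guarded (f + 2) (x + 2) (insert 0 ((· + 2) '' sm)) r →
      Guarded f x sm (.caseList (.var i) s (.lam (.lam r)))
  | letrec {f x : ℕ} {sm : Set ℕ} {t : Tm} :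
      Guarded (f + 2) (x + 2) ((· + 2) '' sm) t → Guarded f x sm (.letrec t)

/-- The body `t` of `letrec f x = t` makes recursive calls on smaller arguments only. -/
def WellDef (t : Tm) : Prop := Guarded 1 0 ∅ t

/-- The types allowed as domains of recursive functions. -/
inductive IsInd : Ty → Prop
  | nat : IsInd .nat
  | list (τ : Ty) : IsInd (.list τ)

/-- The typing judgement `Γ ⊢ t : τ`. -/
inductive HasTy : List Ty → Tm → Ty → Prop
  | var {Γ : List Ty} {i : ℕ} {τ : Ty} : Γ[i]? = some τ → HasTy Γ (.var i) τ
  | pair {Γ : List Ty} {t s : Tm} {σ τ : Ty} :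
      HasTy Γ t σ → HasTy Γ s τ → HasTy Γ (.pair t s) (.prod σ τ)
  | fst {Γ : List Ty} {t : Tm} {σ τ : Ty} : HasTy Γ t (.prod σ τ) → HasTy Γ (.fst t) σ
  | snd {Γ : List Ty} {t : Tm} {σ τ : Ty} : HasTy Γ t (.prod σ τ) → HasTy Γ (.snd t) τ
  | app {Γ : List Ty} {t s : Tm} {τ σ : Ty} :
      HasTy Γ t (.arr τ σ) → HasTy Γ s τ → HasTy Γ (.app t s) σ
  | lam {Γ : List Ty} {t : Tm} {τ σ : Ty} : HasTy (τ :: Γ) t σ → HasTy Γ (.lam t) (.arr τ σ)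
  | tt {Γ : List Ty} : HasTy Γ .tt .bool
  | ff {Γ : List Ty} : HasTy Γ .ff .bool
  | zero {Γ : List Ty} : HasTy Γ .zero .nat
  | nil {Γ : List Ty} {τ : Ty} : HasTy Γ .nil (.list τ)
  | succ {Γ : List Ty} {t : Tm} : HasTy Γ t .nat → HasTy Γ (.succ t) .nat
  | cons {Γ : List Ty} {t s : Tm} {τ : Ty} :
      HasTy Γ t τ → HasTy Γ s (.list τ) → HasTy Γ (.cons t s) (.list τ)
  | caseBool {Γ : List Ty} {t s r : Tm} {σ : Ty} :
      HasTy Γ t .bool → HasTy Γ s σ → HasTy Γ r σ → HasTy Γ (.caseBool t s r) σ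
  | caseNat {Γ : List Ty} {t s r : Tm} {σ : Ty} :
      HasTy Γ t .nat → HasTy Γ s σ → HasTy Γ r (.arr .nat σ) → HasTy Γ (.caseNat t s r) σ
  | caseList {Γ : List Ty} {t s r : Tm} {τ σ : Ty} :
      HasTy Γ t (.list τ) → HasTy Γ s σ → HasTy Γ r (.arr τ (.arr (.list τ) σ)) →
      HasTy Γ (.caseList t s r) σ
  | letrec {Γ : List Ty} {t : Tm} {I σ : Ty} :
      IsInd I → WellDef t → HasTy (I :: .arr I σ :: Γ) t σ → HasTy Γ (.letrec t) (.arr I σ)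

/-- The length of a list: `letrec f l = case l of [] ↦ 0; _::_ ↦ λ h t. S (f t)`. -/
def lenTm : Tm := .letrec (.caseList ♯0 .zero (.lam (.lam (.succ (.app ♯3 ♯0)))))

/-- The order of the naturals as a boolean function: `letrec f m = λ n. case m of 0 ↦ tt;
S ↦ λ m'. case n of 0 ↦ ff; S ↦ λ n'. f m' n'`. -/
def leTm : Tm :=
  .letrec (.lam (.caseNat ♯1 .tt (.lam (.caseNat ♯1 .ff (.lam (.app (.app ♯4 ♯1) ♯0))))))

/-- The size `|t|` of an element `t` of the inductive type `I`, as a term of type `ℕ`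
(only used for `ℕ` and lists). -/
def size (I : Ty) (t : Tm) : Tm :=
  match I with
  | .list _ => .app lenTm t
  | _ => t

end PCF

/-! ## Higher-Order Logic -/

namespace HOL
open PCF

/-- Assertions over a set `P` of basic predicate symbols. Equality is a basic predicate at every
type. A quantifier binds one variable. -/
inductive Fml (P : Type u) : Type u
  | pred : P → List Tm → Fml P
  | eq : Ty → Tm → Tm → Fml P
  | top : Fml P
  | bot : Fml P
  | and : Fml P → Fml P → Fml P
  | or : Fml P → Fml P → Fml P
  | imp : Fml P → Fml P → Fml P
  | all : Ty → Fml P → Fml P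
  | ex : Ty → Fml P → Fml P

def Fml.subst {P : Type u} : (ℕ → Tm) → Fml P → Fml P
  | σ, .pred p ts => .pred p (ts.map (Tm.subst σ))
  | σ, .eq τ t s => .eq τ (t.subst σ) (s.subst σ)
  | _, .top => .top
  | _, .bot => .bot
  | σ, .and φ ψ => .and (φ.subst σ) (ψ.subst σ)
  | σ, .or φ ψ => .or (φ.subst σ) (ψ.subst σ)
  | σ, .imp φ ψ => .imp (φ.subst σ) (ψ.subst σ)
  | σ, .all τ φ => .all τ (φ.subst (lift σ))
  | σ, .ex τ φ => .ex τ (φ.subst (lift σ))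

def Fml.neg {P : Type u} (φ : Fml P) : Fml P := .imp φ .bot

def Fml.iff {P : Type u} (φ ψ : Fml P) : Fml P := .and (.imp φ ψ) (.imp ψ φ)

/-- `t ≤ s` for terms of type `ℕ`. -/
def Fml.le {P : Type u} (t s : Tm) : Fml P := .eq .bool (.app (.app leTm t) s) .tt

/-- `t < s` for terms of type `ℕ`. -/
def Fml.lt {P : Type u} (t s : Tm) : Fml P := .le (.succ t) s

/-- `(a, b) < (c, d)`: componentwise `≤`, with at least one strict inequality. -/
def Fml.ltPair {P : Type u} (a b c d : Tm) : Fml P :=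
  .and (.and (.le a c) (.le b d)) (.or (.lt a c) (.lt b d))

/-- Replace the last declared variable by `t`. -/
def Fml.inst {P : Type u} (φ : Fml P) (t : Tm) : Fml P := φ.subst (t ∷ Tm.var)

/-- Replace the last but one declared variable by `t₁` and the last one by `t₂`. -/
def Fml.inst₂ {P : Type u} (φ : Fml P) (t₁ t₂ : Tm) : Fml P := φ.subst (t₂ ∷ t₁ ∷ Tm.var)

/-- The assertions `Ψ` in a context that has `k` more variables. -/
def wk {P : Type u} (k : ℕ) (Ψ : Set (Fml P)) : Set (Fml P) := Fml.subst (sh k) '' Ψ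

/-- The types of the arguments of the basic predicates, and an axiomatization of the predicates
by closed assertions. -/
structure Signature (P : Type u) where
  arity : P → List Ty
  ax : Set (Fml P)

/-- The judgement `Γ ⊢ φ`: well-typed assertions. -/
inductive Wf {P : Type u} (S : Signature P) : List Ty → Fml P → Prop
  | pred {Γ : List Ty} {p : P} {ts : List Tm} :
      List.Forall₂ (HasTy Γ) ts (S.arity p) → Wf S Γ (.pred p ts)
  | eq {Γ : List Ty} {τ : Ty} {t s : Tm} : HasTy Γ t τ → HasTy Γ s τ → Wf S Γ (.eq τ t s)
  | top {Γ : List Ty} : Wf S Γ .top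
  | bot {Γ : List Ty} : Wf S Γ .bot
  | and {Γ : List Ty} {φ ψ : Fml P} : Wf S Γ φ → Wf S Γ ψ → Wf S Γ (.and φ ψ)
  | or {Γ : List Ty} {φ ψ : Fml P} : Wf S Γ φ → Wf S Γ ψ → Wf S Γ (.or φ ψ)
  | imp {Γ : List Ty} {φ ψ : Fml P} : Wf S Γ φ → Wf S Γ ψ → Wf S Γ (.imp φ ψ)
  | all {Γ : List Ty} {τ : Ty} {φ : Fml P} : Wf S (τ :: Γ) φ → Wf S Γ (.all τ φ)
  | ex {Γ : List Ty} {τ : Ty} {φ : Fml P} : Wf S (τ :: Γ) φ → Wf S Γ (.ex τ φ)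

/-- Well-formedness of the judgement `Γ ∣ Ψ ⊢ φ`. -/
def WfJ {P : Type u} (S : Signature P) (Γ : List Ty) (Ψ : Set (Fml P)) (φ : Fml P) : Prop :=
  (∀ ψ ∈ Ψ, Wf S Γ ψ) ∧ Wf S Γ φ

/-- Derivability of `Γ ∣ Ψ ⊢ φ` in HOL. Every rule may only conclude well-formed judgements. -/
inductive Derivable {P : Type u} (S : Signature P) :
    List Ty → Set (Fml P) → Fml P → Prop
  | ax {Γ : List Ty} {Ψ : Set (Fml P)} {φ : Fml P} : WfJ S Γ Ψ φ →
      φ ∈ Ψ → Derivable S Γ Ψ φ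
  /-- the axioms of the basic predicates -/
  | predAx {Γ : List Ty} {Ψ : Set (Fml P)} {φ : Fml P} : WfJ S Γ Ψ φ →
      φ ∈ S.ax → Wf S [] φ → Derivable S Γ Ψ φ
  | conv {Γ : List Ty} {Ψ : Set (Fml P)} {τ : Ty} {t t' : Tm} : WfJ S Γ Ψ (.eq τ t t') →
      HasTy Γ t τ → HasTy Γ t' τ → Conv t t' → Derivable S Γ Ψ (.eq τ t t')
  | subst {Γ : List Ty} {Ψ : Set (Fml P)} {τ : Ty} {t s : Tm} {φ : Fml P} :
      WfJ S Γ Ψ (φ.inst s) → Wf S (τ :: Γ) φ →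
      Derivable S Γ Ψ (φ.inst t) → Derivable S Γ Ψ (.eq τ t s) → Derivable S Γ Ψ (φ.inst s)
  | impI {Γ : List Ty} {Ψ : Set (Fml P)} {φ ψ : Fml P} : WfJ S Γ Ψ (.imp ψ φ) →
      Derivable S Γ (insert ψ Ψ) φ → Derivable S Γ Ψ (.imp ψ φ)
  | impE {Γ : List Ty} {Ψ : Set (Fml P)} {φ ψ : Fml P} : WfJ S Γ Ψ φ →
      Derivable S Γ Ψ (.imp ψ φ) → Derivable S Γ Ψ ψ → Derivable S Γ Ψ φ
  | allI {Γ : List Ty} {Ψ : Set (Fml P)} {σ : Ty} {φ : Fml P} : WfJ S Γ Ψ (.all σ φ) →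
      Derivable S (σ :: Γ) (wk 1 Ψ) φ → Derivable S Γ Ψ (.all σ φ)
  | allE {Γ : List Ty} {Ψ : Set (Fml P)} {σ : Ty} {φ : Fml P} {t : Tm} : WfJ S Γ Ψ (φ.inst t) →
      Derivable S Γ Ψ (.all σ φ) → HasTy Γ t σ → Derivable S Γ Ψ (φ.inst t)
  | exI {Γ : List Ty} {Ψ : Set (Fml P)} {σ : Ty} {φ : Fml P} {t : Tm} : WfJ S Γ Ψ (.ex σ φ) →
      HasTy Γ t σ → Derivable S Γ Ψ (φ.inst t) → Derivable S Γ Ψ (.ex σ φ)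
  | exE {Γ : List Ty} {Ψ : Set (Fml P)} {σ : Ty} {φ ψ : Fml P} : WfJ S Γ Ψ ψ →
      Derivable S Γ Ψ (.ex σ φ) →
      Derivable S (σ :: Γ) (insert φ (wk 1 Ψ)) (ψ.subst (sh 1)) → Derivable S Γ Ψ ψ
  | topI {Γ : List Ty} {Ψ : Set (Fml P)} : WfJ S Γ Ψ .top → Derivable S Γ Ψ .top
  | botE {Γ : List Ty} {Ψ : Set (Fml P)} {φ : Fml P} : WfJ S Γ Ψ φ →
      Derivable S Γ Ψ .bot → Derivable S Γ Ψ φ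
  | andI {Γ : List Ty} {Ψ : Set (Fml P)} {φ ψ : Fml P} : WfJ S Γ Ψ (.and φ ψ) →
      Derivable S Γ Ψ φ → Derivable S Γ Ψ ψ → Derivable S Γ Ψ (.and φ ψ)
  | andE₁ {Γ : List Ty} {Ψ : Set (Fml P)} {φ ψ : Fml P} : WfJ S Γ Ψ φ →
      Derivable S Γ Ψ (.and φ ψ) → Derivable S Γ Ψ φ
  | andE₂ {Γ : List Ty} {Ψ : Set (Fml P)} {φ ψ : Fml P} : WfJ S Γ Ψ ψ →
      Derivable S Γ Ψ (.and φ ψ) → Derivable S Γ Ψ ψ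
  | orI₁ {Γ : List Ty} {Ψ : Set (Fml P)} {φ ψ : Fml P} : WfJ S Γ Ψ (.or φ ψ) →
      Derivable S Γ Ψ φ → Derivable S Γ Ψ (.or φ ψ)
  | orI₂ {Γ : List Ty} {Ψ : Set (Fml P)} {φ ψ : Fml P} : WfJ S Γ Ψ (.or φ ψ) →
      Derivable S Γ Ψ ψ → Derivable S Γ Ψ (.or φ ψ)
  | orE {Γ : List Ty} {Ψ : Set (Fml P)} {φ ψ χ : Fml P} : WfJ S Γ Ψ χ →
      Derivable S Γ Ψ (.or φ ψ) → Derivable S Γ (insert φ Ψ) χ → Derivable S Γ (insert ψ Ψ) χ →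
      Derivable S Γ Ψ χ
  | boolInd {Γ : List Ty} {Ψ : Set (Fml P)} {φ : Fml P} : WfJ S Γ Ψ (.all .bool φ) →
      Derivable S Γ Ψ (φ.inst .tt) → Derivable S Γ Ψ (φ.inst .ff) →
      Derivable S Γ Ψ (.all .bool φ)
  | natInd {Γ : List Ty} {Ψ : Set (Fml P)} {φ : Fml P} : WfJ S Γ Ψ (.all .nat φ) →
      Derivable S Γ Ψ (φ.inst .zero) →
      Derivable S (.nat :: Γ) (insert φ (wk 1 Ψ)) (φ.subst (.succ ♯0 ∷ sh 1)) →
      Derivable S Γ Ψ (.all .nat φ)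
  | listInd {Γ : List Ty} {Ψ : Set (Fml P)} {τ : Ty} {φ : Fml P} :
      WfJ S Γ Ψ (.all (.list τ) φ) →
      Derivable S Γ Ψ (φ.inst .nil) →
      Derivable S (.list τ :: τ :: Γ) (insert (φ.subst (♯0 ∷ sh 2)) (wk 2 Ψ))
        (φ.subst (.cons ♯1 ♯0 ∷ sh 2)) →
      Derivable S Γ Ψ (.all (.list τ) φ)
  /-- strong induction on lists -/
  | slist {Γ : List Ty} {Ψ : Set (Fml P)} {τ : Ty} {φ : Fml P} :
      WfJ S Γ Ψ (.all (.list τ) φ) →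
      Derivable S (.list τ :: Γ)
        (insert (.all (.list τ) (.imp (.lt (size (.list τ) ♯0) (size (.list τ) ♯1))
          (φ.subst (♯0 ∷ sh 2)))) (wk 1 Ψ)) φ →
      Derivable S Γ Ψ (.all (.list τ) φ)
  | ncBool {Γ : List Ty} {Ψ : Set (Fml P)} : WfJ S Γ Ψ (.neg (.eq .bool .tt .ff)) →
      Derivable S Γ Ψ (.neg (.eq .bool .tt .ff))
  | ncNat {Γ : List Ty} {Ψ : Set (Fml P)} {t : Tm} :
      WfJ S Γ Ψ (.neg (.eq .nat .zero (.succ t))) →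
      Derivable S Γ Ψ (.neg (.eq .nat .zero (.succ t)))
  | ncList {Γ : List Ty} {Ψ : Set (Fml P)} {τ : Ty} {h t : Tm} :
      WfJ S Γ Ψ (.neg (.eq (.list τ) .nil (.cons h t))) →
      Derivable S Γ Ψ (.neg (.eq (.list τ) .nil (.cons h t)))
  | succInj {Γ : List Ty} {Ψ : Set (Fml P)} {t t' : Tm} : WfJ S Γ Ψ (.eq .nat t t') →
      Derivable S Γ Ψ (.eq .nat (.succ t) (.succ t')) → Derivable S Γ Ψ (.eq .nat t t')
  | consInj₁ {Γ : List Ty} {Ψ : Set (Fml P)} {τ : Ty} {h h' t t' : Tm} :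
      WfJ S Γ Ψ (.eq τ h h') →
      Derivable S Γ Ψ (.eq (.list τ) (.cons h t) (.cons h' t')) → Derivable S Γ Ψ (.eq τ h h')
  | consInj₂ {Γ : List Ty} {Ψ : Set (Fml P)} {τ : Ty} {h h' t t' : Tm} :
      WfJ S Γ Ψ (.eq (.list τ) t t') →
      Derivable S Γ Ψ (.eq (.list τ) (.cons h t) (.cons h' t')) →
      Derivable S Γ Ψ (.eq (.list τ) t t')

end HOL

/-! ## Unary Higher-Order Logic -/

namespace UHOL
open PCF HOL

/-- Well-formedness of `Γ ∣ Ψ ⊢ t : τ ∣ φ`; in `φ` the variable `♯0` is `r`. -/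
def WfJ {P : Type u} (S : Signature P) (Γ : List Ty) (Ψ : Set (Fml P)) (t : Tm) (τ : Ty)
    (φ : Fml P) : Prop :=
  HasTy Γ t τ ∧ (∀ ψ ∈ Ψ, Wf S Γ ψ) ∧ Wf S (τ :: Γ) φ

/-- `∀ x : τ. φ' ⇒ φ[r x / r]`, where the last declared variables are: in `φ'` the variable `x`,
in `φ` the variables `x, r`, in the result `r`. -/
def arrSpec {P : Type u} (τ : Ty) (φ' φ : Fml P) : Fml P :=
  .all τ (.imp (φ'.subst (♯0 ∷ sh 2)) (φ.subst (.app ♯1 ♯0 ∷ ♯0 ∷ sh 2)))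

/-- Derivability of `Γ ∣ Ψ ⊢ t : τ ∣ φ` in UHOL. Every rule may only conclude well-formed
judgements. -/
inductive Derivable {P : Type u} (S : Signature P) :
    List Ty → Set (Fml P) → Tm → Ty → Fml P → Prop
  | var {Γ : List Ty} {Ψ : Set (Fml P)} {i : ℕ} {σ : Ty} {φ : Fml P} :
      WfJ S Γ Ψ (.var i) σ φ →
      HOL.Derivable S Γ Ψ (φ.inst (.var i)) → Derivable S Γ Ψ (.var i) σ φ
  | abs {Γ : List Ty} {Ψ : Set (Fml P)} {t : Tm} {τ σ : Ty} {φ' φ : Fml P} :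
      WfJ S Γ Ψ (.lam t) (.arr τ σ) (arrSpec τ φ' φ) →
      Derivable S (τ :: Γ) (insert φ' (wk 1 Ψ)) t σ φ →
      Derivable S Γ Ψ (.lam t) (.arr τ σ) (arrSpec τ φ' φ)
  | app {Γ : List Ty} {Ψ : Set (Fml P)} {t s : Tm} {τ σ : Ty} {φ' φ : Fml P} :
      WfJ S Γ Ψ (.app t s) σ (φ.subst (♯0 ∷ s.subst (sh 1) ∷ sh 1)) →
      Derivable S Γ Ψ t (.arr τ σ) (arrSpec τ φ' φ) →
      Derivable S Γ Ψ s τ φ' →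
      Derivable S Γ Ψ (.app t s) σ (φ.subst (♯0 ∷ s.subst (sh 1) ∷ sh 1))
  | tt {Γ : List Ty} {Ψ : Set (Fml P)} {φ : Fml P} : WfJ S Γ Ψ .tt .bool φ →
      HOL.Derivable S Γ Ψ (φ.inst .tt) → Derivable S Γ Ψ .tt .bool φ
  | ff {Γ : List Ty} {Ψ : Set (Fml P)} {φ : Fml P} : WfJ S Γ Ψ .ff .bool φ →
      HOL.Derivable S Γ Ψ (φ.inst .ff) → Derivable S Γ Ψ .ff .bool φ
  | zero {Γ : List Ty} {Ψ : Set (Fml P)} {φ : Fml P} : WfJ S Γ Ψ .zero .nat φ →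
      HOL.Derivable S Γ Ψ (φ.inst .zero) → Derivable S Γ Ψ .zero .nat φ
  | succ {Γ : List Ty} {Ψ : Set (Fml P)} {t : Tm} {φ' φ : Fml P} : WfJ S Γ Ψ (.succ t) .nat φ →
      Derivable S Γ Ψ t .nat φ' →
      HOL.Derivable S Γ Ψ
        (.all .nat (.imp (φ'.subst (♯0 ∷ sh 1)) (φ.subst (.succ ♯0 ∷ sh 1)))) →
      Derivable S Γ Ψ (.succ t) .nat φ
  | nil {Γ : List Ty} {Ψ : Set (Fml P)} {σ : Ty} {φ : Fml P} : WfJ S Γ Ψ .nil (.list σ) φ →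
      HOL.Derivable S Γ Ψ (φ.inst .nil) → Derivable S Γ Ψ .nil (.list σ) φ
  | cons {Γ : List Ty} {Ψ : Set (Fml P)} {h t : Tm} {σ : Ty} {φ' φ'' φ : Fml P} :
      WfJ S Γ Ψ (.cons h t) (.list σ) φ →
      Derivable S Γ Ψ h σ φ' → Derivable S Γ Ψ t (.list σ) φ'' →
      HOL.Derivable S Γ Ψ (.all σ (.all (.list σ)
        (.imp (φ'.subst (♯1 ∷ sh 2)) (.imp (φ''.subst (♯0 ∷ sh 2))
          (φ.subst (.cons ♯1 ♯0 ∷ sh 2)))))) →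
      Derivable S Γ Ψ (.cons h t) (.list σ) φ
  | pair {Γ : List Ty} {Ψ : Set (Fml P)} {t s : Tm} {σ τ : Ty} {φ' φ'' φ : Fml P} :
      WfJ S Γ Ψ (.pair t s) (.prod σ τ) φ →
      Derivable S Γ Ψ t σ φ' → Derivable S Γ Ψ s τ φ'' →
      HOL.Derivable S Γ Ψ (.all σ (.all τ
        (.imp (φ'.subst (♯1 ∷ sh 2)) (.imp (φ''.subst (♯0 ∷ sh 2))
          (φ.subst (.pair ♯1 ♯0 ∷ sh 2)))))) →
      Derivable S Γ Ψ (.pair t s) (.prod σ τ) φ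
  | fst {Γ : List Ty} {Ψ : Set (Fml P)} {t : Tm} {σ τ : Ty} {φ : Fml P} :
      WfJ S Γ Ψ (.fst t) σ φ →
      Derivable S Γ Ψ t (.prod σ τ) (φ.subst (.fst ♯0 ∷ sh 1)) → Derivable S Γ Ψ (.fst t) σ φ
  | snd {Γ : List Ty} {Ψ : Set (Fml P)} {t : Tm} {σ τ : Ty} {φ : Fml P} :
      WfJ S Γ Ψ (.snd t) τ φ →
      Derivable S Γ Ψ t (.prod σ τ) (φ.subst (.snd ♯0 ∷ sh 1)) → Derivable S Γ Ψ (.snd t) τ φ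
  | sub {Γ : List Ty} {Ψ : Set (Fml P)} {t : Tm} {σ : Ty} {φ' φ : Fml P} : WfJ S Γ Ψ t σ φ →
      Derivable S Γ Ψ t σ φ' → HOL.Derivable S Γ Ψ (.imp (φ'.inst t) (φ.inst t)) →
      Derivable S Γ Ψ t σ φ
  | boolcase {Γ : List Ty} {Ψ : Set (Fml P)} {t s r : Tm} {σ : Ty} {φ : Fml P} :
      WfJ S Γ Ψ (.caseBool t s r) σ φ → HasTy Γ t .bool →
      Derivable S Γ (insert (.eq .bool t .tt) Ψ) s σ φ →
      Derivable S Γ (insert (.eq .bool t .ff) Ψ) r σ φ →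
      Derivable S Γ Ψ (.caseBool t s r) σ φ
  | natcase {Γ : List Ty} {Ψ : Set (Fml P)} {t s r : Tm} {σ : Ty} {φ : Fml P} :
      WfJ S Γ Ψ (.caseNat t s r) σ φ → HasTy Γ t .nat →
      Derivable S Γ (insert (.eq .nat t .zero) Ψ) s σ φ →
      Derivable S Γ Ψ r (.arr .nat σ)
        (.all .nat (.imp (.eq .nat (t.subst (sh 2)) (.succ ♯0))
          (φ.subst (.app ♯1 ♯0 ∷ sh 2)))) →
      Derivable S Γ Ψ (.caseNat t s r) σ φ
  | listcase {Γ : List Ty} {Ψ : Set (Fml P)} {t s r : Tm} {τ σ : Ty} {φ : Fml P} :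
      WfJ S Γ Ψ (.caseList t s r) σ φ → HasTy Γ t (.list τ) →
      Derivable S Γ (insert (.eq (.list τ) t .nil) Ψ) s σ φ →
      Derivable S Γ Ψ r (.arr τ (.arr (.list τ) σ))
        (.all τ (.all (.list τ) (.imp (.eq (.list τ) (t.subst (sh 3)) (.cons ♯1 ♯0))
          (φ.subst (.app (.app ♯2 ♯1) ♯0 ∷ sh 3))))) →
      Derivable S Γ Ψ (.caseList t s r) σ φ
  /-- In the premise the variables are `x = ♯0`, `f = ♯1`. -/
  | letrec {Γ : List Ty} {Ψ : Set (Fml P)} {t : Tm} {I σ : Ty} {φ' φ : Fml P} :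
      WfJ S Γ Ψ (.letrec t) (.arr I σ) (arrSpec I φ' φ) → IsInd I → WellDef t →
      Derivable S (I :: .arr I σ :: Γ)
        (insert (.all I (.imp (.lt (size I ♯0) (size I ♯1)) (.imp (φ'.subst (♯0 ∷ sh 3))
            (φ.subst (.app ♯2 ♯0 ∷ ♯0 ∷ sh 3)))))
          (insert (φ'.subst (♯0 ∷ sh 2)) (wk 2 Ψ)))
        t σ (φ.subst (♯0 ∷ ♯1 ∷ sh 3)) →
      Derivable S Γ Ψ (.letrec t) (.arr I σ) (arrSpec I φ' φ)

end UHOL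

/-! ## Relational Higher-Order Logic -/

namespace RHOL
open PCF HOL

/-- Well-formedness of `Γ ∣ Ψ ⊢ t₁ : τ₁ ∼ t₂ : τ₂ ∣ φ`; in `φ` the variable `♯1` is `r₁` and `♯0` is
`r₂`. -/
def WfJ {P : Type u} (S : Signature P) (Γ : List Ty) (Ψ : Set (Fml P)) (t₁ : Tm) (τ₁ : Ty)
    (t₂ : Tm) (τ₂ : Ty) (φ : Fml P) : Prop :=
  HasTy Γ t₁ τ₁ ∧ HasTy Γ t₂ τ₂ ∧ (∀ ψ ∈ Ψ, Wf S Γ ψ) ∧ Wf S (τ₂ :: τ₁ :: Γ) φ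

/-- `∀ x₁ : τ₁, x₂ : τ₂. φ' ⇒ φ[r₁ x₁ / r₁][r₂ x₂ / r₂]`, where the last declared variables are:
in `φ'` the variables `x₁, x₂`, in `φ` the variables `x₁, x₂, r₁, r₂`, in the result `r₁, r₂`. -/
def arrSpec {P : Type u} (τ₁ τ₂ : Ty) (φ' φ : Fml P) : Fml P :=
  .all τ₁ (.all τ₂ (.imp (φ'.subst (♯0 ∷ ♯1 ∷ sh 4))
    (φ.subst (.app ♯2 ♯0 ∷ .app ♯3 ♯1 ∷ ♯0 ∷ ♯1 ∷ sh 4))))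

/-- `∀ x₁ : τ₁. φ' ⇒ φ[r₁ x₁ / r₁]`, where the last declared variables are: in `φ'` the variable `x₁`,
in `φ` the variables `x₁, r₁, r₂`, in the result `r₁, r₂`. -/
def arrSpecL {P : Type u} (τ₁ : Ty) (φ' φ : Fml P) : Fml P :=
  .all τ₁ (.imp (φ'.subst (♯0 ∷ sh 3)) (φ.subst (♯1 ∷ .app ♯2 ♯0 ∷ ♯0 ∷ sh 3)))

/-- `∀ x₂ : τ₂. φ' ⇒ φ[r₂ x₂ / r₂]`, where the last declared variables are: in `φ'` the variable `x₂`,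
in `φ` the variables `x₂, r₁, r₂`, in the result `r₁, r₂`. -/
def arrSpecR {P : Type u} (τ₂ : Ty) (φ' φ : Fml P) : Fml P :=
  .all τ₂ (.imp (φ'.subst (♯0 ∷ sh 3)) (φ.subst (.app ♯1 ♯0 ∷ ♯2 ∷ ♯0 ∷ sh 3)))

/-- Derivability of `Γ ∣ Ψ ⊢ t₁ : σ₁ ∼ t₂ : σ₂ ∣ φ` in RHOL. Every rule may only conclude
well-formed judgements. -/
inductive Derivable {P : Type u} (S : Signature P) :
    List Ty → Set (Fml P) → Tm → Ty → Tm → Ty → Fml P → Prop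
  /- Two-sided rules. -/
  | abs {Γ : List Ty} {Ψ : Set (Fml P)} {t₁ t₂ : Tm} {τ₁ τ₂ σ₁ σ₂ : Ty} {φ' φ : Fml P} :
      WfJ S Γ Ψ (.lam t₁) (.arr τ₁ σ₁) (.lam t₂) (.arr τ₂ σ₂) (arrSpec τ₁ τ₂ φ' φ) →
      Derivable S (τ₂ :: τ₁ :: Γ) (insert φ' (wk 2 Ψ))
        (t₁.subst (♯1 ∷ sh 2)) σ₁ (t₂.subst (♯0 ∷ sh 2)) σ₂ φ →
      Derivable S Γ Ψ (.lam t₁) (.arr τ₁ σ₁) (.lam t₂) (.arr τ₂ σ₂) (arrSpec τ₁ τ₂ φ' φ)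
  | app {Γ : List Ty} {Ψ : Set (Fml P)} {t₁ t₂ s₁ s₂ : Tm} {τ₁ τ₂ σ₁ σ₂ : Ty} {φ' φ : Fml P} :
      WfJ S Γ Ψ (.app t₁ s₁) σ₁ (.app t₂ s₂) σ₂
        (φ.subst (♯0 ∷ ♯1 ∷ s₂.subst (sh 2) ∷ s₁.subst (sh 2) ∷ sh 2)) →
      Derivable S Γ Ψ t₁ (.arr τ₁ σ₁) t₂ (.arr τ₂ σ₂) (arrSpec τ₁ τ₂ φ' φ) →
      Derivable S Γ Ψ s₁ τ₁ s₂ τ₂ φ' →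
      Derivable S Γ Ψ (.app t₁ s₁) σ₁ (.app t₂ s₂) σ₂
        (φ.subst (♯0 ∷ ♯1 ∷ s₂.subst (sh 2) ∷ s₁.subst (sh 2) ∷ sh 2))
  | zero {Γ : List Ty} {Ψ : Set (Fml P)} {φ : Fml P} : WfJ S Γ Ψ .zero .nat .zero .nat φ →
      HOL.Derivable S Γ Ψ (φ.inst₂ .zero .zero) → Derivable S Γ Ψ .zero .nat .zero .nat φ
  | succ {Γ : List Ty} {Ψ : Set (Fml P)} {t₁ t₂ : Tm} {φ' φ : Fml P} :
      WfJ S Γ Ψ (.succ t₁) .nat (.succ t₂) .nat φ →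
      Derivable S Γ Ψ t₁ .nat t₂ .nat φ' →
      HOL.Derivable S Γ Ψ (.all .nat (.all .nat (.imp (φ'.subst (♯0 ∷ ♯1 ∷ sh 2))
        (φ.subst (.succ ♯0 ∷ .succ ♯1 ∷ sh 2))))) →
      Derivable S Γ Ψ (.succ t₁) .nat (.succ t₂) .nat φ
  | var {Γ : List Ty} {Ψ : Set (Fml P)} {i j : ℕ} {σ₁ σ₂ : Ty} {φ : Fml P} :
      WfJ S Γ Ψ (.var i) σ₁ (.var j) σ₂ φ →
      HOL.Derivable S Γ Ψ (φ.inst₂ (.var i) (.var j)) →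
      Derivable S Γ Ψ (.var i) σ₁ (.var j) σ₂ φ
  | tt {Γ : List Ty} {Ψ : Set (Fml P)} {φ : Fml P} : WfJ S Γ Ψ .tt .bool .tt .bool φ →
      HOL.Derivable S Γ Ψ (φ.inst₂ .tt .tt) → Derivable S Γ Ψ .tt .bool .tt .bool φ
  | ff {Γ : List Ty} {Ψ : Set (Fml P)} {φ : Fml P} : WfJ S Γ Ψ .ff .bool .ff .bool φ →
      HOL.Derivable S Γ Ψ (φ.inst₂ .ff .ff) → Derivable S Γ Ψ .ff .bool .ff .bool φ
  | nil {Γ : List Ty} {Ψ : Set (Fml P)} {σ₁ σ₂ : Ty} {φ : Fml P} :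
      WfJ S Γ Ψ .nil (.list σ₁) .nil (.list σ₂) φ →
      HOL.Derivable S Γ Ψ (φ.inst₂ .nil .nil) →
      Derivable S Γ Ψ .nil (.list σ₁) .nil (.list σ₂) φ
  | cons {Γ : List Ty} {Ψ : Set (Fml P)} {h₁ h₂ t₁ t₂ : Tm} {σ₁ σ₂ : Ty} {φ' φ'' φ : Fml P} :
      WfJ S Γ Ψ (.cons h₁ t₁) (.list σ₁) (.cons h₂ t₂) (.list σ₂) φ →
      Derivable S Γ Ψ h₁ σ₁ h₂ σ₂ φ' → Derivable S Γ Ψ t₁ (.list σ₁) t₂ (.list σ₂) φ'' →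
      HOL.Derivable S Γ Ψ (.all σ₁ (.all σ₂ (.all (.list σ₁) (.all (.list σ₂)
        (.imp (φ'.subst (♯2 ∷ ♯3 ∷ sh 4)) (.imp (φ''.subst (♯0 ∷ ♯1 ∷ sh 4))
          (φ.subst (.cons ♯2 ♯0 ∷ .cons ♯3 ♯1 ∷ sh 4)))))))) →
      Derivable S Γ Ψ (.cons h₁ t₁) (.list σ₁) (.cons h₂ t₂) (.list σ₂) φ
  | pair {Γ : List Ty} {Ψ : Set (Fml P)} {t₁ t₂ s₁ s₂ : Tm} {σ₁ σ₂ τ₁ τ₂ : Ty}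
      {φ' φ'' φ : Fml P} :
      WfJ S Γ Ψ (.pair t₁ s₁) (.prod σ₁ τ₁) (.pair t₂ s₂) (.prod σ₂ τ₂) φ →
      Derivable S Γ Ψ t₁ σ₁ t₂ σ₂ φ' → Derivable S Γ Ψ s₁ τ₁ s₂ τ₂ φ'' →
      HOL.Derivable S Γ Ψ (.all σ₁ (.all σ₂ (.all τ₁ (.all τ₂
        (.imp (φ'.subst (♯2 ∷ ♯3 ∷ sh 4)) (.imp (φ''.subst (♯0 ∷ ♯1 ∷ sh 4))
          (φ.subst (.pair ♯2 ♯0 ∷ .pair ♯3 ♯1 ∷ sh 4)))))))) →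
      Derivable S Γ Ψ (.pair t₁ s₁) (.prod σ₁ τ₁) (.pair t₂ s₂) (.prod σ₂ τ₂) φ
  | fst {Γ : List Ty} {Ψ : Set (Fml P)} {t₁ t₂ : Tm} {σ₁ σ₂ τ₁ τ₂ : Ty} {φ : Fml P} :
      WfJ S Γ Ψ (.fst t₁) σ₁ (.fst t₂) σ₂ φ →
      Derivable S Γ Ψ t₁ (.prod σ₁ τ₁) t₂ (.prod σ₂ τ₂) (φ.subst (.fst ♯0 ∷ .fst ♯1 ∷ sh 2)) →
      Derivable S Γ Ψ (.fst t₁) σ₁ (.fst t₂) σ₂ φ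
  | snd {Γ : List Ty} {Ψ : Set (Fml P)} {t₁ t₂ : Tm} {σ₁ σ₂ τ₁ τ₂ : Ty} {φ : Fml P} :
      WfJ S Γ Ψ (.snd t₁) τ₁ (.snd t₂) τ₂ φ →
      Derivable S Γ Ψ t₁ (.prod σ₁ τ₁) t₂ (.prod σ₂ τ₂) (φ.subst (.snd ♯0 ∷ .snd ♯1 ∷ sh 2)) →
      Derivable S Γ Ψ (.snd t₁) τ₁ (.snd t₂) τ₂ φ
  | boolcase {Γ : List Ty} {Ψ : Set (Fml P)} {t₁ t₂ s₁ s₂ r₁ r₂ : Tm} {σ₁ σ₂ : Ty} {φ : Fml P} :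
      WfJ S Γ Ψ (.caseBool t₁ s₁ r₁) σ₁ (.caseBool t₂ s₂ r₂) σ₂ φ →
      Derivable S Γ Ψ t₁ .bool t₂ .bool
        (.or (.and (.eq .bool ♯1 .tt) (.eq .bool ♯0 .tt))
          (.and (.eq .bool ♯1 .ff) (.eq .bool ♯0 .ff))) →
      Derivable S Γ (insert (.eq .bool t₂ .tt) (insert (.eq .bool t₁ .tt) Ψ)) s₁ σ₁ s₂ σ₂ φ →
      Derivable S Γ (insert (.eq .bool t₂ .ff) (insert (.eq .bool t₁ .ff) Ψ)) r₁ σ₁ r₂ σ₂ φ →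
      Derivable S Γ Ψ (.caseBool t₁ s₁ r₁) σ₁ (.caseBool t₂ s₂ r₂) σ₂ φ
  | natcase {Γ : List Ty} {Ψ : Set (Fml P)} {t₁ t₂ s₁ s₂ r₁ r₂ : Tm} {σ₁ σ₂ : Ty} {φ : Fml P} :
      WfJ S Γ Ψ (.caseNat t₁ s₁ r₁) σ₁ (.caseNat t₂ s₂ r₂) σ₂ φ →
      Derivable S Γ Ψ t₁ .nat t₂ .nat (.iff (.eq .nat ♯1 .zero) (.eq .nat ♯0 .zero)) →
      Derivable S Γ (insert (.eq .nat t₂ .zero) (insert (.eq .nat t₁ .zero) Ψ)) s₁ σ₁ s₂ σ₂ φ →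
      Derivable S Γ Ψ r₁ (.arr .nat σ₁) r₂ (.arr .nat σ₂)
        (.all .nat (.all .nat (.imp (.eq .nat (t₁.subst (sh 4)) (.succ ♯1))
          (.imp (.eq .nat (t₂.subst (sh 4)) (.succ ♯0))
            (φ.subst (.app ♯2 ♯0 ∷ .app ♯3 ♯1 ∷ sh 4)))))) →
      Derivable S Γ Ψ (.caseNat t₁ s₁ r₁) σ₁ (.caseNat t₂ s₂ r₂) σ₂ φ
  | listcase {Γ : List Ty} {Ψ : Set (Fml P)} {t₁ t₂ s₁ s₂ r₁ r₂ : Tm} {τ₁ τ₂ σ₁ σ₂ : Ty}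
      {φ : Fml P} :
      WfJ S Γ Ψ (.caseList t₁ s₁ r₁) σ₁ (.caseList t₂ s₂ r₂) σ₂ φ →
      Derivable S Γ Ψ t₁ (.list τ₁) t₂ (.list τ₂)
        (.iff (.eq (.list τ₁) ♯1 .nil) (.eq (.list τ₂) ♯0 .nil)) →
      Derivable S Γ (insert (.eq (.list τ₂) t₂ .nil) (insert (.eq (.list τ₁) t₁ .nil) Ψ))
        s₁ σ₁ s₂ σ₂ φ →
      Derivable S Γ Ψ r₁ (.arr τ₁ (.arr (.list τ₁) σ₁)) r₂ (.arr τ₂ (.arr (.list τ₂) σ₂))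
        (.all τ₁ (.all τ₂ (.all (.list τ₁) (.all (.list τ₂)
          (.imp (.eq (.list τ₁) (t₁.subst (sh 6)) (.cons ♯3 ♯1))
            (.imp (.eq (.list τ₂) (t₂.subst (sh 6)) (.cons ♯2 ♯0))
              (φ.subst (.app (.app ♯4 ♯2) ♯0 ∷ .app (.app ♯5 ♯3) ♯1 ∷ sh 6)))))))) →
      Derivable S Γ Ψ (.caseList t₁ s₁ r₁) σ₁ (.caseList t₂ s₂ r₂) σ₂ φ
  /- Structural rules. -/
  | sub {Γ : List Ty} {Ψ : Set (Fml P)} {t₁ t₂ : Tm} {σ₁ σ₂ : Ty} {φ' φ : Fml P} :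
      WfJ S Γ Ψ t₁ σ₁ t₂ σ₂ φ →
      Derivable S Γ Ψ t₁ σ₁ t₂ σ₂ φ' →
      HOL.Derivable S Γ Ψ (.imp (φ'.inst₂ t₁ t₂) (φ.inst₂ t₁ t₂)) →
      Derivable S Γ Ψ t₁ σ₁ t₂ σ₂ φ
  | andI {Γ : List Ty} {Ψ : Set (Fml P)} {t₁ t₂ : Tm} {σ₁ σ₂ : Ty} {φ φ' : Fml P} :
      WfJ S Γ Ψ t₁ σ₁ t₂ σ₂ (.and φ φ') →
      Derivable S Γ Ψ t₁ σ₁ t₂ σ₂ φ → Derivable S Γ Ψ t₁ σ₁ t₂ σ₂ φ' →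
      Derivable S Γ Ψ t₁ σ₁ t₂ σ₂ (.and φ φ')
  | impI {Γ : List Ty} {Ψ : Set (Fml P)} {t₁ t₂ : Tm} {σ₁ σ₂ : Ty} {φ' φ : Fml P} :
      WfJ S Γ Ψ t₁ σ₁ t₂ σ₂ (.imp φ' φ) →
      Derivable S Γ (insert (φ'.inst₂ t₁ t₂) Ψ) t₁ σ₁ t₂ σ₂ φ →
      Derivable S Γ Ψ t₁ σ₁ t₂ σ₂ (.imp φ' φ)
  | uholL {Γ : List Ty} {Ψ : Set (Fml P)} {t₁ t₂ : Tm} {σ₁ σ₂ : Ty} {φ : Fml P} :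
      WfJ S Γ Ψ t₁ σ₁ t₂ σ₂ φ →
      UHOL.Derivable S Γ Ψ t₁ σ₁ (φ.subst (t₂.subst (sh 1) ∷ ♯0 ∷ sh 1)) →
      Derivable S Γ Ψ t₁ σ₁ t₂ σ₂ φ
  | uholR {Γ : List Ty} {Ψ : Set (Fml P)} {t₁ t₂ : Tm} {σ₁ σ₂ : Ty} {φ : Fml P} :
      WfJ S Γ Ψ t₁ σ₁ t₂ σ₂ φ →
      UHOL.Derivable S Γ Ψ t₂ σ₂ (φ.subst (♯0 ∷ t₁.subst (sh 1) ∷ sh 1)) →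
      Derivable S Γ Ψ t₁ σ₁ t₂ σ₂ φ
  /- One-sided rules, left. -/
  | absL {Γ : List Ty} {Ψ : Set (Fml P)} {t₁ t₂ : Tm} {τ₁ σ₁ σ₂ : Ty} {φ' φ : Fml P} :
      WfJ S Γ Ψ (.lam t₁) (.arr τ₁ σ₁) t₂ σ₂ (arrSpecL τ₁ φ' φ) →
      Derivable S (τ₁ :: Γ) (insert φ' (wk 1 Ψ)) t₁ σ₁ (t₂.subst (sh 1)) σ₂ φ →
      Derivable S Γ Ψ (.lam t₁) (.arr τ₁ σ₁) t₂ σ₂ (arrSpecL τ₁ φ' φ)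
  | appL {Γ : List Ty} {Ψ : Set (Fml P)} {t₁ s₁ t₂ : Tm} {τ₁ σ₁ σ₂ : Ty} {φ' φ : Fml P} :
      WfJ S Γ Ψ (.app t₁ s₁) σ₁ t₂ σ₂ (φ.subst (♯0 ∷ ♯1 ∷ s₁.subst (sh 2) ∷ sh 2)) →
      Derivable S Γ Ψ t₁ (.arr τ₁ σ₁) t₂ σ₂ (arrSpecL τ₁ φ' φ) →
      UHOL.Derivable S Γ Ψ s₁ τ₁ φ' →
      Derivable S Γ Ψ (.app t₁ s₁) σ₁ t₂ σ₂ (φ.subst (♯0 ∷ ♯1 ∷ s₁.subst (sh 2) ∷ sh 2))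
  /-- Here `φ` does not mention `r₂`: its last declared variable is `r₁`. -/
  | varL {Γ : List Ty} {Ψ : Set (Fml P)} {i : ℕ} {t₂ : Tm} {σ₁ σ₂ : Ty} {φ : Fml P} :
      WfJ S Γ Ψ (.var i) σ₁ t₂ σ₂ (φ.subst (♯1 ∷ sh 2)) →
      φ.inst (.var i) ∈ Ψ → Derivable S Γ Ψ (.var i) σ₁ t₂ σ₂ (φ.subst (♯1 ∷ sh 2))
  | zeroL {Γ : List Ty} {Ψ : Set (Fml P)} {t₂ : Tm} {σ₂ : Ty} {φ : Fml P} :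
      WfJ S Γ Ψ .zero .nat t₂ σ₂ φ →
      HOL.Derivable S Γ Ψ (φ.inst₂ .zero t₂) → Derivable S Γ Ψ .zero .nat t₂ σ₂ φ
  | succL {Γ : List Ty} {Ψ : Set (Fml P)} {t₁ t₂ : Tm} {σ₂ : Ty} {φ' φ : Fml P} :
      WfJ S Γ Ψ (.succ t₁) .nat t₂ σ₂ φ →
      Derivable S Γ Ψ t₁ .nat t₂ σ₂ φ' →
      HOL.Derivable S Γ Ψ (.all .nat (.all σ₂ (.imp (φ'.subst (♯0 ∷ ♯1 ∷ sh 2))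
        (φ.subst (♯0 ∷ .succ ♯1 ∷ sh 2))))) →
      Derivable S Γ Ψ (.succ t₁) .nat t₂ σ₂ φ
  | ttL {Γ : List Ty} {Ψ : Set (Fml P)} {t₂ : Tm} {σ₂ : Ty} {φ : Fml P} :
      WfJ S Γ Ψ .tt .bool t₂ σ₂ φ →
      HOL.Derivable S Γ Ψ (φ.inst₂ .tt t₂) → Derivable S Γ Ψ .tt .bool t₂ σ₂ φ
  | ffL {Γ : List Ty} {Ψ : Set (Fml P)} {t₂ : Tm} {σ₂ : Ty} {φ : Fml P} :
      WfJ S Γ Ψ .ff .bool t₂ σ₂ φ →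
      HOL.Derivable S Γ Ψ (φ.inst₂ .ff t₂) → Derivable S Γ Ψ .ff .bool t₂ σ₂ φ
  | nilL {Γ : List Ty} {Ψ : Set (Fml P)} {t₂ : Tm} {σ₁ σ₂ : Ty} {φ : Fml P} :
      WfJ S Γ Ψ .nil (.list σ₁) t₂ σ₂ φ →
      HOL.Derivable S Γ Ψ (φ.inst₂ .nil t₂) → Derivable S Γ Ψ .nil (.list σ₁) t₂ σ₂ φ
  | consL {Γ : List Ty} {Ψ : Set (Fml P)} {h₁ t₁ t₂ : Tm} {σ₁ σ₂ : Ty} {φ' φ'' φ : Fml P} :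
      WfJ S Γ Ψ (.cons h₁ t₁) (.list σ₁) t₂ σ₂ φ →
      Derivable S Γ Ψ h₁ σ₁ t₂ σ₂ φ' → Derivable S Γ Ψ t₁ (.list σ₁) t₂ σ₂ φ'' →
      HOL.Derivable S Γ Ψ (.all σ₁ (.all σ₂ (.all (.list σ₁)
        (.imp (φ'.subst (♯1 ∷ ♯2 ∷ sh 3)) (.imp (φ''.subst (♯1 ∷ ♯0 ∷ sh 3))
          (φ.subst (♯1 ∷ .cons ♯2 ♯0 ∷ sh 3))))))) →
      Derivable S Γ Ψ (.cons h₁ t₁) (.list σ₁) t₂ σ₂ φ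
  | pairL {Γ : List Ty} {Ψ : Set (Fml P)} {t₁ s₁ t₂ : Tm} {σ₁ τ₁ σ₂ : Ty} {φ' φ'' φ : Fml P} :
      WfJ S Γ Ψ (.pair t₁ s₁) (.prod σ₁ τ₁) t₂ σ₂ φ →
      Derivable S Γ Ψ t₁ σ₁ t₂ σ₂ φ' → Derivable S Γ Ψ s₁ τ₁ t₂ σ₂ φ'' →
      HOL.Derivable S Γ Ψ (.all σ₁ (.all σ₂ (.all τ₁
        (.imp (φ'.subst (♯1 ∷ ♯2 ∷ sh 3)) (.imp (φ''.subst (♯1 ∷ ♯0 ∷ sh 3))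
          (φ.subst (♯1 ∷ .pair ♯2 ♯0 ∷ sh 3))))))) →
      Derivable S Γ Ψ (.pair t₁ s₁) (.prod σ₁ τ₁) t₂ σ₂ φ
  | fstL {Γ : List Ty} {Ψ : Set (Fml P)} {t₁ t₂ : Tm} {σ₁ τ₁ σ₂ : Ty} {φ : Fml P} :
      WfJ S Γ Ψ (.fst t₁) σ₁ t₂ σ₂ φ →
      Derivable S Γ Ψ t₁ (.prod σ₁ τ₁) t₂ σ₂ (φ.subst (♯0 ∷ .fst ♯1 ∷ sh 2)) →
      Derivable S Γ Ψ (.fst t₁) σ₁ t₂ σ₂ φ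
  | sndL {Γ : List Ty} {Ψ : Set (Fml P)} {t₁ t₂ : Tm} {σ₁ τ₁ σ₂ : Ty} {φ : Fml P} :
      WfJ S Γ Ψ (.snd t₁) τ₁ t₂ σ₂ φ →
      Derivable S Γ Ψ t₁ (.prod σ₁ τ₁) t₂ σ₂ (φ.subst (♯0 ∷ .snd ♯1 ∷ sh 2)) →
      Derivable S Γ Ψ (.snd t₁) τ₁ t₂ σ₂ φ
  | boolcaseL {Γ : List Ty} {Ψ : Set (Fml P)} {t₁ s₁ r₁ t₂ : Tm} {σ₁ σ₂ : Ty} {φ : Fml P} :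
      WfJ S Γ Ψ (.caseBool t₁ s₁ r₁) σ₁ t₂ σ₂ φ → HasTy Γ t₁ .bool →
      Derivable S Γ (insert (.eq .bool t₁ .tt) Ψ) s₁ σ₁ t₂ σ₂ φ →
      Derivable S Γ (insert (.eq .bool t₁ .ff) Ψ) r₁ σ₁ t₂ σ₂ φ →
      Derivable S Γ Ψ (.caseBool t₁ s₁ r₁) σ₁ t₂ σ₂ φ
  | natcaseL {Γ : List Ty} {Ψ : Set (Fml P)} {t₁ s₁ r₁ t₂ : Tm} {σ₁ σ₂ : Ty} {φ : Fml P} :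
      WfJ S Γ Ψ (.caseNat t₁ s₁ r₁) σ₁ t₂ σ₂ φ → HasTy Γ t₁ .nat →
      Derivable S Γ (insert (.eq .nat t₁ .zero) Ψ) s₁ σ₁ t₂ σ₂ φ →
      Derivable S Γ Ψ r₁ (.arr .nat σ₁) t₂ σ₂
        (.all .nat (.imp (.eq .nat (t₁.subst (sh 3)) (.succ ♯0))
          (φ.subst (♯1 ∷ .app ♯2 ♯0 ∷ sh 3)))) →
      Derivable S Γ Ψ (.caseNat t₁ s₁ r₁) σ₁ t₂ σ₂ φ
  | listcaseL {Γ : List Ty} {Ψ : Set (Fml P)} {t₁ s₁ r₁ t₂ : Tm} {τ₁ σ₁ σ₂ : Ty} {φ : Fml P} :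
      WfJ S Γ Ψ (.caseList t₁ s₁ r₁) σ₁ t₂ σ₂ φ → HasTy Γ t₁ (.list τ₁) →
      Derivable S Γ (insert (.eq (.list τ₁) t₁ .nil) Ψ) s₁ σ₁ t₂ σ₂ φ →
      Derivable S Γ Ψ r₁ (.arr τ₁ (.arr (.list τ₁) σ₁)) t₂ σ₂
        (.all τ₁ (.all (.list τ₁) (.imp (.eq (.list τ₁) (t₁.subst (sh 4)) (.cons ♯1 ♯0))
          (φ.subst (♯2 ∷ .app (.app ♯3 ♯1) ♯0 ∷ sh 4))))) →
      Derivable S Γ Ψ (.caseList t₁ s₁ r₁) σ₁ t₂ σ₂ φ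
  /- One-sided rules, right. -/
  | absR {Γ : List Ty} {Ψ : Set (Fml P)} {t₁ t₂ : Tm} {σ₁ τ₂ σ₂ : Ty} {φ' φ : Fml P} :
      WfJ S Γ Ψ t₁ σ₁ (.lam t₂) (.arr τ₂ σ₂) (arrSpecR τ₂ φ' φ) →
      Derivable S (τ₂ :: Γ) (insert φ' (wk 1 Ψ)) (t₁.subst (sh 1)) σ₁ t₂ σ₂ φ →
      Derivable S Γ Ψ t₁ σ₁ (.lam t₂) (.arr τ₂ σ₂) (arrSpecR τ₂ φ' φ)
  | appR {Γ : List Ty} {Ψ : Set (Fml P)} {t₁ t₂ s₂ : Tm} {σ₁ τ₂ σ₂ : Ty} {φ' φ : Fml P} :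
      WfJ S Γ Ψ t₁ σ₁ (.app t₂ s₂) σ₂ (φ.subst (♯0 ∷ ♯1 ∷ s₂.subst (sh 2) ∷ sh 2)) →
      Derivable S Γ Ψ t₁ σ₁ t₂ (.arr τ₂ σ₂) (arrSpecR τ₂ φ' φ) →
      UHOL.Derivable S Γ Ψ s₂ τ₂ φ' →
      Derivable S Γ Ψ t₁ σ₁ (.app t₂ s₂) σ₂ (φ.subst (♯0 ∷ ♯1 ∷ s₂.subst (sh 2) ∷ sh 2))
  /-- Here `φ` does not mention `r₁`: its last declared variable is `r₂`. -/
  | varR {Γ : List Ty} {Ψ : Set (Fml P)} {t₁ : Tm} {i : ℕ} {σ₁ σ₂ : Ty} {φ : Fml P} :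
      WfJ S Γ Ψ t₁ σ₁ (.var i) σ₂ (φ.subst (♯0 ∷ sh 2)) →
      φ.inst (.var i) ∈ Ψ → Derivable S Γ Ψ t₁ σ₁ (.var i) σ₂ (φ.subst (♯0 ∷ sh 2))
  | zeroR {Γ : List Ty} {Ψ : Set (Fml P)} {t₁ : Tm} {σ₁ : Ty} {φ : Fml P} :
      WfJ S Γ Ψ t₁ σ₁ .zero .nat φ →
      HOL.Derivable S Γ Ψ (φ.inst₂ t₁ .zero) → Derivable S Γ Ψ t₁ σ₁ .zero .nat φ
  | succR {Γ : List Ty} {Ψ : Set (Fml P)} {t₁ t₂ : Tm} {σ₁ : Ty} {φ' φ : Fml P} :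
      WfJ S Γ Ψ t₁ σ₁ (.succ t₂) .nat φ →
      Derivable S Γ Ψ t₁ σ₁ t₂ .nat φ' →
      HOL.Derivable S Γ Ψ (.all σ₁ (.all .nat (.imp (φ'.subst (♯0 ∷ ♯1 ∷ sh 2))
        (φ.subst (.succ ♯0 ∷ ♯1 ∷ sh 2))))) →
      Derivable S Γ Ψ t₁ σ₁ (.succ t₂) .nat φ
  | ttR {Γ : List Ty} {Ψ : Set (Fml P)} {t₁ : Tm} {σ₁ : Ty} {φ : Fml P} :
      WfJ S Γ Ψ t₁ σ₁ .tt .bool φ →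
      HOL.Derivable S Γ Ψ (φ.inst₂ t₁ .tt) → Derivable S Γ Ψ t₁ σ₁ .tt .bool φ
  | ffR {Γ : List Ty} {Ψ : Set (Fml P)} {t₁ : Tm} {σ₁ : Ty} {φ : Fml P} :
      WfJ S Γ Ψ t₁ σ₁ .ff .bool φ →
      HOL.Derivable S Γ Ψ (φ.inst₂ t₁ .ff) → Derivable S Γ Ψ t₁ σ₁ .ff .bool φ
  | nilR {Γ : List Ty} {Ψ : Set (Fml P)} {t₁ : Tm} {σ₁ σ₂ : Ty} {φ : Fml P} :
      WfJ S Γ Ψ t₁ σ₁ .nil (.list σ₂) φ →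
      HOL.Derivable S Γ Ψ (φ.inst₂ t₁ .nil) → Derivable S Γ Ψ t₁ σ₁ .nil (.list σ₂) φ
  | consR {Γ : List Ty} {Ψ : Set (Fml P)} {t₁ h₂ t₂ : Tm} {σ₁ σ₂ : Ty} {φ' φ'' φ : Fml P} :
      WfJ S Γ Ψ t₁ σ₁ (.cons h₂ t₂) (.list σ₂) φ →
      Derivable S Γ Ψ t₁ σ₁ h₂ σ₂ φ' → Derivable S Γ Ψ t₁ σ₁ t₂ (.list σ₂) φ'' →
      HOL.Derivable S Γ Ψ (.all σ₁ (.all σ₂ (.all (.list σ₂)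
        (.imp (φ'.subst (♯1 ∷ ♯2 ∷ sh 3)) (.imp (φ''.subst (♯0 ∷ ♯2 ∷ sh 3))
          (φ.subst (.cons ♯1 ♯0 ∷ ♯2 ∷ sh 3))))))) →
      Derivable S Γ Ψ t₁ σ₁ (.cons h₂ t₂) (.list σ₂) φ
  | pairR {Γ : List Ty} {Ψ : Set (Fml P)} {t₁ t₂ s₂ : Tm} {σ₁ σ₂ τ₂ : Ty} {φ' φ'' φ : Fml P} :
      WfJ S Γ Ψ t₁ σ₁ (.pair t₂ s₂) (.prod σ₂ τ₂) φ →
      Derivable S Γ Ψ t₁ σ₁ t₂ σ₂ φ' → Derivable S Γ Ψ t₁ σ₁ s₂ τ₂ φ'' →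
      HOL.Derivable S Γ Ψ (.all σ₁ (.all σ₂ (.all τ₂
        (.imp (φ'.subst (♯1 ∷ ♯2 ∷ sh 3)) (.imp (φ''.subst (♯0 ∷ ♯2 ∷ sh 3))
          (φ.subst (.pair ♯1 ♯0 ∷ ♯2 ∷ sh 3))))))) →
      Derivable S Γ Ψ t₁ σ₁ (.pair t₂ s₂) (.prod σ₂ τ₂) φ
  | fstR {Γ : List Ty} {Ψ : Set (Fml P)} {t₁ t₂ : Tm} {σ₁ σ₂ τ₂ : Ty} {φ : Fml P} :
      WfJ S Γ Ψ t₁ σ₁ (.fst t₂) σ₂ φ →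
      Derivable S Γ Ψ t₁ σ₁ t₂ (.prod σ₂ τ₂) (φ.subst (.fst ♯0 ∷ ♯1 ∷ sh 2)) →
      Derivable S Γ Ψ t₁ σ₁ (.fst t₂) σ₂ φ
  | sndR {Γ : List Ty} {Ψ : Set (Fml P)} {t₁ t₂ : Tm} {σ₁ σ₂ τ₂ : Ty} {φ : Fml P} :
      WfJ S Γ Ψ t₁ σ₁ (.snd t₂) τ₂ φ →
      Derivable S Γ Ψ t₁ σ₁ t₂ (.prod σ₂ τ₂) (φ.subst (.snd ♯0 ∷ ♯1 ∷ sh 2)) →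
      Derivable S Γ Ψ t₁ σ₁ (.snd t₂) τ₂ φ
  | boolcaseR {Γ : List Ty} {Ψ : Set (Fml P)} {t₁ t₂ s₂ r₂ : Tm} {σ₁ σ₂ : Ty} {φ : Fml P} :
      WfJ S Γ Ψ t₁ σ₁ (.caseBool t₂ s₂ r₂) σ₂ φ → HasTy Γ t₂ .bool →
      Derivable S Γ (insert (.eq .bool t₂ .tt) Ψ) t₁ σ₁ s₂ σ₂ φ →
      Derivable S Γ (insert (.eq .bool t₂ .ff) Ψ) t₁ σ₁ r₂ σ₂ φ →
      Derivable S Γ Ψ t₁ σ₁ (.caseBool t₂ s₂ r₂) σ₂ φ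
  | natcaseR {Γ : List Ty} {Ψ : Set (Fml P)} {t₁ t₂ s₂ r₂ : Tm} {σ₁ σ₂ : Ty} {φ : Fml P} :
      WfJ S Γ Ψ t₁ σ₁ (.caseNat t₂ s₂ r₂) σ₂ φ → HasTy Γ t₂ .nat →
      Derivable S Γ (insert (.eq .nat t₂ .zero) Ψ) t₁ σ₁ s₂ σ₂ φ →
      Derivable S Γ Ψ t₁ σ₁ r₂ (.arr .nat σ₂)
        (.all .nat (.imp (.eq .nat (t₂.subst (sh 3)) (.succ ♯0))
          (φ.subst (.app ♯1 ♯0 ∷ ♯2 ∷ sh 3)))) →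
      Derivable S Γ Ψ t₁ σ₁ (.caseNat t₂ s₂ r₂) σ₂ φ
  | listcaseR {Γ : List Ty} {Ψ : Set (Fml P)} {t₁ t₂ s₂ r₂ : Tm} {σ₁ τ₂ σ₂ : Ty} {φ : Fml P} :
      WfJ S Γ Ψ t₁ σ₁ (.caseList t₂ s₂ r₂) σ₂ φ → HasTy Γ t₂ (.list τ₂) →
      Derivable S Γ (insert (.eq (.list τ₂) t₂ .nil) Ψ) t₁ σ₁ s₂ σ₂ φ →
      Derivable S Γ Ψ t₁ σ₁ r₂ (.arr τ₂ (.arr (.list τ₂) σ₂))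
        (.all τ₂ (.all (.list τ₂) (.imp (.eq (.list τ₂) (t₂.subst (sh 4)) (.cons ♯1 ♯0))
          (φ.subst (.app (.app ♯2 ♯1) ♯0 ∷ ♯3 ∷ sh 4))))) →
      Derivable S Γ Ψ t₁ σ₁ (.caseList t₂ s₂ r₂) σ₂ φ
  /- Recursion rules. -/
  /-- In the premise the variables are `x₂ = ♯0`, `x₁ = ♯1`, `f₂ = ♯2`, `f₁ = ♯3`. -/
  | letrec {Γ : List Ty} {Ψ : Set (Fml P)} {t₁ t₂ : Tm} {I₁ I₂ σ₁ σ₂ : Ty} {φ' φ : Fml P} :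
      WfJ S Γ Ψ (.letrec t₁) (.arr I₁ σ₁) (.letrec t₂) (.arr I₂ σ₂) (arrSpec I₁ I₂ φ' φ) →
      IsInd I₁ → IsInd I₂ → WellDef t₁ → WellDef t₂ →
      Derivable S (I₂ :: I₁ :: .arr I₂ σ₂ :: .arr I₁ σ₁ :: Γ)
        (insert (.all I₁ (.all I₂
            (.imp (.ltPair (size I₁ ♯1) (size I₂ ♯0) (size I₁ ♯3) (size I₂ ♯2))
              (.imp (φ'.subst (♯0 ∷ ♯1 ∷ sh 6))
                (φ.subst (.app ♯4 ♯0 ∷ .app ♯5 ♯1 ∷ ♯0 ∷ ♯1 ∷ sh 6))))))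
          (insert (φ'.subst (♯0 ∷ ♯1 ∷ sh 4)) (wk 4 Ψ)))
        (t₁.subst (♯1 ∷ ♯3 ∷ sh 4)) σ₁ (t₂.subst (♯0 ∷ ♯2 ∷ sh 4)) σ₂
        (φ.subst (♯0 ∷ ♯1 ∷ ♯2 ∷ ♯3 ∷ sh 6)) →
      Derivable S Γ Ψ (.letrec t₁) (.arr I₁ σ₁) (.letrec t₂) (.arr I₂ σ₂)
        (arrSpec I₁ I₂ φ' φ)
  /-- In the premise the variables are `x₁ = ♯0`, `f₁ = ♯1`. -/
  | letrecL {Γ : List Ty} {Ψ : Set (Fml P)} {t₁ t₂ : Tm} {I₁ σ₁ σ₂ : Ty} {φ' φ : Fml P} :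
      WfJ S Γ Ψ (.letrec t₁) (.arr I₁ σ₁) t₂ σ₂ (arrSpecL I₁ φ' φ) →
      IsInd I₁ → WellDef t₁ →
      Derivable S (I₁ :: .arr I₁ σ₁ :: Γ)
        (insert (.all I₁ (.imp (.lt (size I₁ ♯0) (size I₁ ♯1))
            (.imp (φ'.subst (♯0 ∷ sh 3))
              (φ.subst (t₂.subst (sh 3) ∷ .app ♯2 ♯0 ∷ ♯0 ∷ sh 3)))))
          (insert (φ'.subst (♯0 ∷ sh 2)) (wk 2 Ψ)))
        t₁ σ₁ (t₂.subst (sh 2)) σ₂ (φ.subst (♯0 ∷ ♯1 ∷ ♯2 ∷ sh 4)) →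
      Derivable S Γ Ψ (.letrec t₁) (.arr I₁ σ₁) t₂ σ₂ (arrSpecL I₁ φ' φ)
  /-- In the premise the variables are `x₂ = ♯0`, `f₂ = ♯1`. -/
  | letrecR {Γ : List Ty} {Ψ : Set (Fml P)} {t₁ t₂ : Tm} {σ₁ I₂ σ₂ : Ty} {φ' φ : Fml P} :
      WfJ S Γ Ψ t₁ σ₁ (.letrec t₂) (.arr I₂ σ₂) (arrSpecR I₂ φ' φ) →
      IsInd I₂ → WellDef t₂ →
      Derivable S (I₂ :: .arr I₂ σ₂ :: Γ)
        (insert (.all I₂ (.imp (.lt (size I₂ ♯0) (size I₂ ♯1))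
            (.imp (φ'.subst (♯0 ∷ sh 3))
              (φ.subst (.app ♯2 ♯0 ∷ t₁.subst (sh 3) ∷ ♯0 ∷ sh 3)))))
          (insert (φ'.subst (♯0 ∷ sh 2)) (wk 2 Ψ)))
        (t₁.subst (sh 2)) σ₁ t₂ σ₂ (φ.subst (♯0 ∷ ♯1 ∷ ♯2 ∷ sh 4)) →
      Derivable S Γ Ψ t₁ σ₁ (.letrec t₂) (.arr I₂ σ₂) (arrSpecR I₂ φ' φ)

end RHOL

/-! ## The Dependency Core Calculus (without recursion) over the lattice `{L, H}` -/

namespace DCC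

inductive Label : Type
  | L : Label
  | H : Label

/-- The order with `L ⊏ H`. -/
def Label.le : Label → Label → Prop
  | .H, .L => False
  | _, _ => True

instance : LE Label := ⟨Label.le⟩

instance (a b : Label) : Decidable (a ≤ b) :=
  match a, b with
  | .H, .L => isFalse (fun h => h)
  | .L, .L => isTrue trivial
  | .L, .H => isTrue trivial
  | .H, .H => isTrue trivial

inductive Ty : Type
  | bool : Ty
  | arr : Ty → Ty → Ty
  | prod : Ty → Ty → Ty
  | mon : Label → Ty → Ty

/-- Expressions. `lam e` binds one variable of `e`; `bind e₁ e₂` is `bind(e₁, x.e₂)` and binds one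
variable of `e₂`; `ret ℓ e` is the return `η_ℓ(e)`. -/
inductive Expr : Type
  | var : ℕ → Expr
  | lam : Expr → Expr
  | app : Expr → Expr → Expr
  | tt : Expr
  | ff : Expr
  | caseBool : Expr → Expr → Expr → Expr
  | pair : Expr → Expr → Expr
  | fst : Expr → Expr
  | snd : Expr → Expr
  | ret : Label → Expr → Expr
  | bind : Expr → Expr → Expr

def Expr.rename : (ℕ → ℕ) → Expr → Expr
  | ξ, .var i => .var (ξ i)
  | ξ, .lam e => .lam (e.rename (PCF.liftRen ξ))
  | ξ, .app e e' => .app (e.rename ξ) (e'.rename ξ)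
  | _, .tt => .tt
  | _, .ff => .ff
  | ξ, .caseBool e e₁ e₂ => .caseBool (e.rename ξ) (e₁.rename ξ) (e₂.rename ξ)
  | ξ, .pair e e' => .pair (e.rename ξ) (e'.rename ξ)
  | ξ, .fst e => .fst (e.rename ξ)
  | ξ, .snd e => .snd (e.rename ξ)
  | ξ, .ret l e => .ret l (e.rename ξ)
  | ξ, .bind e e' => .bind (e.rename ξ) (e'.rename (PCF.liftRen ξ))

def liftE (σ : ℕ → Expr) : ℕ → Expr
  | 0 => .var 0
  | n + 1 => (σ n).rename (· + 1)

def Expr.subst : (ℕ → Expr) → Expr → Expr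
  | σ, .var i => σ i
  | σ, .lam e => .lam (e.subst (liftE σ))
  | σ, .app e e' => .app (e.subst σ) (e'.subst σ)
  | _, .tt => .tt
  | _, .ff => .ff
  | σ, .caseBool e e₁ e₂ => .caseBool (e.subst σ) (e₁.subst σ) (e₂.subst σ)
  | σ, .pair e e' => .pair (e.subst σ) (e'.subst σ)
  | σ, .fst e => .fst (e.subst σ)
  | σ, .snd e => .snd (e.subst σ)
  | σ, .ret l e => .ret l (e.subst σ)
  | σ, .bind e e' => .bind (e.subst σ) (e'.subst (liftE σ))

/-- `e[e' / x]` for the last declared variable `x`. -/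
def Expr.inst (e e' : Expr) : Expr :=
  e.subst (fun n => match n with
    | 0 => e'
    | n + 1 => .var n)

/-- `Protected τ ℓ`: the type `τ` is protected at level `ℓ`. -/
inductive Protected : Ty → Label → Prop
  | here {l l' : Label} {τ : Ty} : l ≤ l' → Protected (.mon l' τ) l
  | mon {l l' : Label} {τ : Ty} : Protected τ l → Protected (.mon l' τ) l
  | prod {l : Label} {τ₁ τ₂ : Ty} : Protected τ₁ l → Protected τ₂ l → Protected (.prod τ₁ τ₂) l
  | arr {l : Label} {τ₁ τ₂ : Ty} : Protected τ₂ l → Protected (.arr τ₁ τ₂) l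

/-- The typing judgement `Γ ⊢ e : τ` of DCC. -/
inductive HasTy : List Ty → Expr → Ty → Prop
  | var {Γ : List Ty} {i : ℕ} {τ : Ty} : Γ[i]? = some τ → HasTy Γ (.var i) τ
  | lam {Γ : List Ty} {e : Expr} {τ₁ τ₂ : Ty} :
      HasTy (τ₁ :: Γ) e τ₂ → HasTy Γ (.lam e) (.arr τ₁ τ₂)
  | app {Γ : List Ty} {e e' : Expr} {τ₁ τ₂ : Ty} :
      HasTy Γ e (.arr τ₁ τ₂) → HasTy Γ e' τ₁ → HasTy Γ (.app e e') τ₂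
  | tt {Γ : List Ty} : HasTy Γ .tt .bool
  | ff {Γ : List Ty} : HasTy Γ .ff .bool
  | caseBool {Γ : List Ty} {e e₁ e₂ : Expr} {τ : Ty} :
      HasTy Γ e .bool → HasTy Γ e₁ τ → HasTy Γ e₂ τ → HasTy Γ (.caseBool e e₁ e₂) τ
  | pair {Γ : List Ty} {e e' : Expr} {τ₁ τ₂ : Ty} :
      HasTy Γ e τ₁ → HasTy Γ e' τ₂ → HasTy Γ (.pair e e') (.prod τ₁ τ₂)
  | fst {Γ : List Ty} {e : Expr} {τ₁ τ₂ : Ty} : HasTy Γ e (.prod τ₁ τ₂) → HasTy Γ (.fst e) τ₁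
  | snd {Γ : List Ty} {e : Expr} {τ₁ τ₂ : Ty} : HasTy Γ e (.prod τ₁ τ₂) → HasTy Γ (.snd e) τ₂
  | ret {Γ : List Ty} {l : Label} {e : Expr} {τ : Ty} :
      HasTy Γ e τ → HasTy Γ (.ret l e) (.mon l τ)
  | bind {Γ : List Ty} {l : Label} {e₁ e₂ : Expr} {τ₁ τ₂ : Ty} :
      HasTy Γ e₁ (.mon l τ₁) → HasTy (τ₁ :: Γ) e₂ τ₂ → Protected τ₂ l →
      HasTy Γ (.bind e₁ e₂) τ₂

/-! ### The embedding into RHOL -/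

/-- The erasure `|τ|`. -/
def Ty.erase : Ty → PCF.Ty
  | .bool => .bool
  | .arr τ₁ τ₂ => .arr τ₁.erase τ₂.erase
  | .prod τ₁ τ₂ => .prod τ₁.erase τ₂.erase
  | .mon _ τ => τ.erase

/-- The erasure `|e|`. -/
def Expr.erase : Expr → PCF.Tm
  | .var i => .var i
  | .lam e => .lam e.erase
  | .app e e' => .app e.erase e'.erase
  | .tt => .tt
  | .ff => .ff
  | .caseBool e e₁ e₂ => .caseBool e.erase e₁.erase e₂.erase
  | .pair e e' => .pair e.erase e'.erase
  | .fst e => .fst e.erase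
  | .snd e => .snd e.erase
  | .ret _ e => e.erase
  | .bind e₁ e₂ => .app (.lam e₂.erase) e₁.erase

/-- The context `|Γ|`: each `x : τ` is replaced by `x₁ : |τ|, x₂ : |τ|`. So if `x` is the variable
`i` of `Γ`, then `x₁` is the variable `2 * i + 1` of `|Γ|` and `x₂` is the variable `2 * i`. -/
def eraseCtx : List Ty → List PCF.Ty
  | [] => []
  | τ :: Γ => τ.erase :: τ.erase :: eraseCtx Γ

/-- `|e|₁`: the erasure with each variable `x` replaced by `x₁`. -/
def Expr.erase₁ (e : Expr) : PCF.Tm := e.erase.subst (fun i => ♯(2 * i + 1))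

/-- `|e|₂`: the erasure with each variable `x` replaced by `x₂`. -/
def Expr.erase₂ (e : Expr) : PCF.Tm := e.erase.subst (fun i => ♯(2 * i))

/-- The assertion `⌊τ⌋_a (x, y)`. -/
def rel (P : Type u) (a : Label) : Ty → PCF.Tm → PCF.Tm → HOL.Fml P
  | .bool, x, y =>
      .or (.and (.eq .bool x .tt) (.eq .bool y .tt)) (.and (.eq .bool x .ff) (.eq .bool y .ff))
  | .arr τ₁ τ₂, x, y =>
      .all τ₁.erase (.all τ₁.erase (.imp (rel P a τ₁ ♯1 ♯0)
        (rel P a τ₂ (.app (x.subst (PCF.sh 2)) ♯1) (.app (y.subst (PCF.sh 2)) ♯0))))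
  | .prod τ₁ τ₂, x, y =>
      .and (rel P a τ₁ (.fst x) (.fst y)) (rel P a τ₂ (.snd x) (.snd y))
  | .mon l τ, x, y => if l ≤ a then rel P a τ x y else .top

/-- The set `⌊Γ⌋_a` of the assertions `⌊τ⌋_a (x₁, x₂)` for `x : τ` in `Γ`. -/
def relCtx (P : Type u) (a : Label) : List Ty → Set (HOL.Fml P)
  | [] => ∅
  | τ :: Γ => insert (rel P a τ ♯1 ♯0) (HOL.wk 2 (relCtx P a Γ))

/-! ### The set-theoretic model -/

/-- The carrier set `|τ|`. -/
def Ty.carrier : Ty → Type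
  | .bool => Bool
  | .arr τ₁ τ₂ => τ₁.carrier → τ₂.carrier
  | .prod τ₁ τ₂ => τ₁.carrier × τ₂.carrier
  | .mon _ τ => τ.carrier

/-- `Den ρ e τ v`: under the valuation `ρ` (a list of typed values, one for each declared variable)
the expression `e`, taken at type `τ`, denotes the element `v` of the carrier of `τ`. Since
abstractions do not carry types, this is a relation. -/
inductive Den : List (Σ τ : Ty, τ.carrier) → Expr → (τ : Ty) → τ.carrier → Prop
  | var {ρ : List (Σ τ : Ty, τ.carrier)} {i : ℕ} {τ : Ty} {v : τ.carrier} :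
      ρ[i]? = some ⟨τ, v⟩ → Den ρ (.var i) τ v
  | lam {ρ : List (Σ τ : Ty, τ.carrier)} {e : Expr} {τ₁ τ₂ : Ty}
      (f : τ₁.carrier → τ₂.carrier) :
      (∀ v : τ₁.carrier, Den (⟨τ₁, v⟩ :: ρ) e τ₂ (f v)) → Den ρ (.lam e) (.arr τ₁ τ₂) f
  | app {ρ : List (Σ τ : Ty, τ.carrier)} {e e' : Expr} {τ₁ τ₂ : Ty}
      (f : τ₁.carrier → τ₂.carrier) (v : τ₁.carrier) :
      Den ρ e (.arr τ₁ τ₂) f → Den ρ e' τ₁ v → Den ρ (.app e e') τ₂ (f v)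
  | tt {ρ : List (Σ τ : Ty, τ.carrier)} : Den ρ .tt .bool true
  | ff {ρ : List (Σ τ : Ty, τ.carrier)} : Den ρ .ff .bool false
  | caseBool {ρ : List (Σ τ : Ty, τ.carrier)} {e e₁ e₂ : Expr} {τ : Ty} (b : Bool)
      (v₁ v₂ : τ.carrier) :
      Den ρ e .bool b → Den ρ e₁ τ v₁ → Den ρ e₂ τ v₂ →
      Den ρ (.caseBool e e₁ e₂) τ (if b then v₁ else v₂)
  | pair {ρ : List (Σ τ : Ty, τ.carrier)} {e e' : Expr} {τ₁ τ₂ : Ty} (v₁ : τ₁.carrier)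
      (v₂ : τ₂.carrier) :
      Den ρ e τ₁ v₁ → Den ρ e' τ₂ v₂ → Den ρ (.pair e e') (.prod τ₁ τ₂) (v₁, v₂)
  | fst {ρ : List (Σ τ : Ty, τ.carrier)} {e : Expr} {τ₁ τ₂ : Ty}
      (p : τ₁.carrier × τ₂.carrier) :
      Den ρ e (.prod τ₁ τ₂) p → Den ρ (.fst e) τ₁ p.1
  | snd {ρ : List (Σ τ : Ty, τ.carrier)} {e : Expr} {τ₁ τ₂ : Ty}
      (p : τ₁.carrier × τ₂.carrier) :
      Den ρ e (.prod τ₁ τ₂) p → Den ρ (.snd e) τ₂ p.2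
  | ret {ρ : List (Σ τ : Ty, τ.carrier)} {l : Label} {e : Expr} {τ : Ty} (v : τ.carrier) :
      Den ρ e τ v → Den ρ (.ret l e) (.mon l τ) v
  | bind {ρ : List (Σ τ : Ty, τ.carrier)} {l : Label} {e₁ e₂ : Expr} {τ₁ τ₂ : Ty}
      (v : τ₁.carrier) (w : τ₂.carrier) :
      Den ρ e₁ (.mon l τ₁) v → Den (⟨τ₁, v⟩ :: ρ) e₂ τ₂ w → Den ρ (.bind e₁ e₂) τ₂ w

/-- The closed expression `e` of type `T_ℓ(𝔹)` denotes the boolean `b`, and nothing else. -/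
def DenotesBool (l : Label) (e : Expr) (b : Bool) : Prop :=
  ∀ c : Bool, Den [] e (.mon l .bool) c ↔ c = b

end DCC

/-! ### Substitution calculus; stability of guardedness and typing under renaming. -/

namespace PCF

/-! Soundness is an induction on DCC typing (`HasTy.derivable_rel`). Most constructs are matched by
the two-sided RHOL rule of the same name, because the specification of functions in RHOL, taken at
the assertions $\lfloor\tau_i\rfloor_a$, is literally $\lfloor\tau_1\to\tau_2\rfloor_a$
(`arrSpec_rel`). The interesting constructs are `ret` and `bind`. If $\ell\sqsubseteq a$, then
$T_\ell$ is transparent: `ret` changes nothing, and `bind` is the application of an abstraction. If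
$\ell\not\sqsubseteq a$, the result type is protected at $\ell$, and its assertion is built from
$\top$ so that it holds of any two terms (`rel_isTrivial`). It then suffices to have some RHOL
derivation for the two erasures. One with postcondition $\top$ comes from UHOL
(`HasTy.derivable_top`), and the subsumption rule does the rest (`derivable_of_protected`).

Noninterference is proved directly in the model, without passing through the logic. Every typed
expression denotes a function of its valuation that preserves indistinguishability at all observer
levels (`HasTy.exists_den`). For the observer $\ell'$, any two inputs of type $T_\ell(\mathbb B)$
are indistinguishable, while outputs of type $T_{\ell'}(\mathbb B)$ are indistinguishable only if
equal.

Uniqueness needs its own argument: abstractions carry no types, so two derivations of `Den` for one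
expression may pass through different intermediate types. The erasure is common to both. By a
realizability argument (`Den.realizes`) it head-reduces to each denoted boolean, and head reduction
is deterministic. -/

theorem liftRen_injective {ξ : ℕ → ℕ} (h : Function.Injective ξ) :
    Function.Injective (liftRen ξ) := by
  rintro (_ | i) (_ | j) hij <;> simp_all [liftRen]
  exact h hij

theorem lift_var_comp (ξ : ℕ → ℕ) : lift (fun i => ♯(ξ i)) = fun i => ♯(liftRen ξ i) := by
  funext i; cases i <;> rfl

theorem lift_var : lift Tm.var = Tm.var := by
  funext i; cases i <;> rfl

theorem lift_comp_liftRen (σ : ℕ → Tm) (ξ : ℕ → ℕ) :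
    (fun i => lift σ (liftRen ξ i)) = lift (fun i => σ (ξ i)) := by
  funext i; cases i <;> rfl

theorem Tm.rename_eq_subst (t : Tm) (ξ : ℕ → ℕ) : t.rename ξ = t.subst (fun i => ♯(ξ i)) := by
  induction t generalizing ξ <;> simp_all [Tm.rename, Tm.subst, lift_var_comp]

theorem Tm.subst_var (t : Tm) : t.subst Tm.var = t := by
  induction t <;> simp_all [Tm.subst, lift_var]

/-- Since `lift` weakens by a renaming, composing two substitutions below a binder requires both
mixed laws first: renaming then substituting, and substituting then renaming. -/
theorem Tm.rename_subst (t : Tm) (ξ : ℕ → ℕ) (σ : ℕ → Tm) :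
    (t.rename ξ).subst σ = t.subst (fun i => σ (ξ i)) := by
  induction t generalizing ξ σ <;> simp_all [Tm.rename, Tm.subst, lift_comp_liftRen]

theorem rename_lift_liftRen (σ : ℕ → Tm) (ξ : ℕ → ℕ) :
    (fun i => (lift σ i).rename (liftRen ξ)) = lift (fun i => (σ i).rename ξ) := by
  funext i
  cases i with
  | zero => rfl
  | succ i => simp only [lift, Tm.rename_eq_subst (Tm.rename _ _), Tm.rename_subst]; rfl

theorem Tm.subst_rename (t : Tm) (σ : ℕ → Tm) (ξ : ℕ → ℕ) :
    (t.subst σ).rename ξ = t.subst (fun i => (σ i).rename ξ) := by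
  induction t generalizing ξ σ <;> simp_all [Tm.rename, Tm.subst, rename_lift_liftRen]

theorem subst_lift_lift (σ θ : ℕ → Tm) :
    (fun i => (lift σ i).subst (lift θ)) = lift (fun i => (σ i).subst θ) := by
  funext i
  cases i with
  | zero => rfl
  | succ i => simp only [lift, Tm.rename_subst, Tm.subst_rename]

theorem Tm.subst_subst (t : Tm) (σ θ : ℕ → Tm) :
    (t.subst σ).subst θ = t.subst (fun i => (σ i).subst θ) := by
  induction t generalizing σ θ <;> simp_all [Tm.subst, subst_lift_lift]

/-- Serves the two quantifiers of $\lfloor\tau_1\to\tau_2\rfloor_a$, below which the related terms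
are weakened by two. -/
theorem Tm.subst_sh_lift_lift (t : Tm) (σ : ℕ → Tm) :
    (t.subst (sh 2)).subst (lift (lift σ)) = (t.subst σ).subst (sh 2) := by
  simp only [Tm.subst_subst]
  congr 1
  funext i
  simp only [sh, Tm.subst, lift, Tm.rename_eq_subst, Tm.subst_subst]
  rfl

theorem Tm.subst_sh_one_scons (t s : Tm) : (t.subst (sh 1)).subst (s ∷ Tm.var) = t := by
  rw [Tm.subst_subst]
  exact t.subst_var

/-- Contracting a β-redex whose abstraction has already been substituted into amounts to extending
the substitution by the argument. -/
theorem Tm.subst_lift_scons (t s : Tm) (σ : ℕ → Tm) :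
    (t.subst (lift σ)).subst (s ∷ Tm.var) = t.subst (s ∷ σ) := by
  rw [Tm.subst_subst]
  congr 1
  funext i
  cases i with
  | zero => rfl
  | succ i => rw [lift, Tm.rename_subst]; exact (σ i).subst_var

/-- Injectivity is essential: guardedness contains the disequalities `i ≠ f`, and a renaming that
merges variables could turn a harmless variable into the recursive function. -/
theorem Guarded.rename {f x : ℕ} {sm : Set ℕ} {t : Tm} (h : Guarded f x sm t) :
    ∀ {ξ : ℕ → ℕ}, Function.Injective ξ → Guarded (ξ f) (ξ x) (ξ '' sm) (t.rename ξ) := by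
  have step (ξ : ℕ → ℕ) (sm : Set ℕ) :
      liftRen ξ '' ((· + 1) '' sm) = (· + 1) '' (ξ '' sm) := by
    simp only [Set.image_image, liftRen]
  have step₂ (ξ : ℕ → ℕ) (sm : Set ℕ) :
      liftRen (liftRen ξ) '' ((· + 2) '' sm) = (· + 2) '' (ξ '' sm) := by
    simp only [Set.image_image, liftRen]
  induction h with
  | var h => exact fun hξ => .var (hξ.ne h)
  | call h => exact fun _ => .call ⟨_, h, rfl⟩
  | pair _ _ ih₁ ih₂ => exact fun hξ => .pair (ih₁ hξ) (ih₂ hξ)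
  | fst _ ih => exact fun hξ => .fst (ih hξ)
  | snd _ ih => exact fun hξ => .snd (ih hξ)
  | app _ _ ih₁ ih₂ => exact fun hξ => .app (ih₁ hξ) (ih₂ hξ)
  | lam _ ih => exact fun hξ => .lam (step _ _ ▸ ih (liftRen_injective hξ))
  | tt => exact fun _ => .tt
  | ff => exact fun _ => .ff
  | zero => exact fun _ => .zero
  | nil => exact fun _ => .nil
  | succ _ ih => exact fun hξ => .succ (ih hξ)
  | cons _ _ ih₁ ih₂ => exact fun hξ => .cons (ih₁ hξ) (ih₂ hξ)
  | caseBool _ _ _ ih₁ ih₂ ih₃ => exact fun hξ => .caseBool (ih₁ hξ) (ih₂ hξ) (ih₃ hξ)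
  | caseNat _ _ _ ih₁ ih₂ ih₃ => exact fun hξ => .caseNat (ih₁ hξ) (ih₂ hξ) (ih₃ hξ)
  | caseList _ _ _ ih₁ ih₂ ih₃ => exact fun hξ => .caseList (ih₁ hξ) (ih₂ hξ) (ih₃ hξ)
  | destrNat hf hx _ _ ih₁ ih₂ =>
    intro ξ hξ
    refine .destrNat (hξ.ne hf) (hx.imp (congrArg ξ) fun h => ⟨_, h, rfl⟩) (ih₁ hξ) ?_
    have := ih₂ (liftRen_injective hξ)
    rwa [Set.image_insert_eq, step] at this
  | destrList hf hx _ _ ih₁ ih₂ =>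
    intro ξ hξ
    refine .destrList (hξ.ne hf) (hx.imp (congrArg ξ) fun h => ⟨_, h, rfl⟩) (ih₁ hξ) ?_
    have := ih₂ (liftRen_injective (liftRen_injective hξ))
    rwa [Set.image_insert_eq, step₂] at this
  | letrec _ ih =>
    exact fun hξ => .letrec (step₂ _ _ ▸ ih (liftRen_injective (liftRen_injective hξ)))

theorem WellDef.rename {t : Tm} (h : WellDef t) {ξ : ℕ → ℕ} (hξ : Function.Injective ξ) :
    WellDef (t.rename (liftRen (liftRen ξ))) := by
  have := Guarded.rename h (liftRen_injective (liftRen_injective hξ))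
  rwa [Set.image_empty] at this

/-- `ξ` maps the variables of `Γ` to variables of `Δ` of the same types. -/
def TypedRen (ξ : ℕ → ℕ) (Γ Δ : List Ty) : Prop :=
  ∀ (i : ℕ) (τ : Ty), Γ[i]? = some τ → Δ[ξ i]? = some τ

theorem TypedRen.liftRen {ξ : ℕ → ℕ} {Γ Δ : List Ty} (h : TypedRen ξ Γ Δ) (τ : Ty) :
    TypedRen (liftRen ξ) (τ :: Γ) (τ :: Δ) := by
  rintro (_ | i) σ hi
  · exact hi
  · exact h i σ hi

/-- Erased expressions contain no recursion, but this is applied to the terms inside arbitrary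
assertions, so `letrec` must be covered; it is the only source of the injectivity condition. -/
theorem HasTy.rename {Γ : List Ty} {t : Tm} {τ : Ty} (h : HasTy Γ t τ) :
    ∀ {Δ : List Ty} {ξ : ℕ → ℕ}, Function.Injective ξ → TypedRen ξ Γ Δ →
      HasTy Δ (t.rename ξ) τ := by
  induction h with
  | var h => exact fun _ hr => .var (hr _ _ h)
  | pair _ _ ih₁ ih₂ => exact fun hξ hr => .pair (ih₁ hξ hr) (ih₂ hξ hr)
  | fst _ ih => exact fun hξ hr => .fst (ih hξ hr)
  | snd _ ih => exact fun hξ hr => .snd (ih hξ hr)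
  | app _ _ ih₁ ih₂ => exact fun hξ hr => .app (ih₁ hξ hr) (ih₂ hξ hr)
  | lam _ ih => exact fun hξ hr => .lam (ih (liftRen_injective hξ) (hr.liftRen _))
  | tt => exact fun _ _ => .tt
  | ff => exact fun _ _ => .ff
  | zero => exact fun _ _ => .zero
  | nil => exact fun _ _ => .nil
  | succ _ ih => exact fun hξ hr => .succ (ih hξ hr)
  | cons _ _ ih₁ ih₂ => exact fun hξ hr => .cons (ih₁ hξ hr) (ih₂ hξ hr)
  | caseBool _ _ _ ih₁ ih₂ ih₃ =>
    exact fun hξ hr => .caseBool (ih₁ hξ hr) (ih₂ hξ hr) (ih₃ hξ hr)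
  | caseNat _ _ _ ih₁ ih₂ ih₃ => exact fun hξ hr => .caseNat (ih₁ hξ hr) (ih₂ hξ hr) (ih₃ hξ hr)
  | caseList _ _ _ ih₁ ih₂ ih₃ =>
    exact fun hξ hr => .caseList (ih₁ hξ hr) (ih₂ hξ hr) (ih₃ hξ hr)
  | letrec hI hw _ ih =>
    exact fun hξ hr => .letrec hI (hw.rename hξ)
      (ih (liftRen_injective (liftRen_injective hξ)) ((hr.liftRen _).liftRen _))

theorem typedRen_add_one (τ : Ty) (Γ : List Ty) : TypedRen (· + 1) Γ (τ :: Γ) :=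
  fun _ _ h => h

theorem typedRen_add_two (σ τ : Ty) (Γ : List Ty) : TypedRen (· + 2) Γ (σ :: τ :: Γ) :=
  fun _ _ h => h

theorem HasTy.sh_one {Γ : List Ty} {t : Tm} {τ : Ty} (h : HasTy Γ t τ) (σ : Ty) :
    HasTy (σ :: Γ) (t.subst (sh 1)) τ :=
  Tm.rename_eq_subst t _ ▸ h.rename (add_left_injective 1) (typedRen_add_one σ Γ)

theorem HasTy.sh_two {Γ : List Ty} {t : Tm} {τ : Ty} (h : HasTy Γ t τ) (σ σ' : Ty) :
    HasTy (σ :: σ' :: Γ) (t.subst (sh 2)) τ :=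
  Tm.rename_eq_subst t _ ▸ h.rename (add_left_injective 2) (typedRen_add_two σ σ' Γ)

end PCF

/-! ### Weakening of assertions; assertions derivable by introduction rules alone. -/

namespace HOL
open PCF

variable {P : Type u} {S : Signature P}

theorem Wf.rename {Γ : List Ty} {φ : Fml P} (h : Wf S Γ φ) :
    ∀ {Δ : List Ty} {ξ : ℕ → ℕ}, Function.Injective ξ → TypedRen ξ Γ Δ →
      Wf S Δ (φ.subst fun i => ♯(ξ i)) := by
  induction h with
  | pred h =>
    intro Δ ξ hξ hr
    refine .pred ?_
    rw [List.forall₂_map_left_iff]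
    exact h.imp fun t τ ht => Tm.rename_eq_subst t ξ ▸ ht.rename hξ hr
  | eq h₁ h₂ =>
    intro Δ ξ hξ hr
    exact .eq (Tm.rename_eq_subst _ ξ ▸ h₁.rename hξ hr) (Tm.rename_eq_subst _ ξ ▸ h₂.rename hξ hr)
  | top => exact fun _ _ => .top
  | bot => exact fun _ _ => .bot
  | and _ _ ih₁ ih₂ => exact fun hξ hr => .and (ih₁ hξ hr) (ih₂ hξ hr)
  | or _ _ ih₁ ih₂ => exact fun hξ hr => .or (ih₁ hξ hr) (ih₂ hξ hr)
  | imp _ _ ih₁ ih₂ => exact fun hξ hr => .imp (ih₁ hξ hr) (ih₂ hξ hr)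
  | all _ ih =>
    exact fun hξ hr => .all (lift_var_comp _ ▸ ih (liftRen_injective hξ) (hr.liftRen _))
  | ex _ ih =>
    exact fun hξ hr => .ex (lift_var_comp _ ▸ ih (liftRen_injective hξ) (hr.liftRen _))

/-- All assertions of `Ψ` are well typed in `Γ`. -/
def WfCtx (S : Signature P) (Γ : List Ty) (Ψ : Set (Fml P)) : Prop := ∀ ψ ∈ Ψ, Wf S Γ ψ

theorem WfCtx.insert {Γ : List Ty} {Ψ : Set (Fml P)} {φ : Fml P} (hΨ : WfCtx S Γ Ψ)
    (hφ : Wf S Γ φ) : WfCtx S Γ (insert φ Ψ) := by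
  rintro ψ (rfl | h)
  · exact hφ
  · exact hΨ ψ h

theorem WfCtx.wk_one {Γ : List Ty} {Ψ : Set (Fml P)} (hΨ : WfCtx S Γ Ψ) (τ : Ty) :
    WfCtx S (τ :: Γ) (wk 1 Ψ) := by
  rintro _ ⟨ψ, h, rfl⟩
  exact (hΨ ψ h).rename (add_left_injective 1) (typedRen_add_one τ Γ)

theorem WfCtx.wk_two {Γ : List Ty} {Ψ : Set (Fml P)} (hΨ : WfCtx S Γ Ψ) (σ τ : Ty) :
    WfCtx S (σ :: τ :: Γ) (wk 2 Ψ) := by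
  rintro _ ⟨ψ, h, rfl⟩
  exact (hΨ ψ h).rename (add_left_injective 2) (typedRen_add_two σ τ Γ)

/-- Assertions that hold for no other reason than their occurrences of `⊤`. -/
inductive Fml.IsTrivial : Fml P → Prop
  | top : IsTrivial .top
  | and {φ ψ : Fml P} : IsTrivial φ → IsTrivial ψ → IsTrivial (.and φ ψ)
  | imp {φ ψ : Fml P} : IsTrivial ψ → IsTrivial (.imp φ ψ)
  | all {τ : Ty} {φ : Fml P} : IsTrivial φ → IsTrivial (.all τ φ)

/-- Introduction rules suffice. The context and the hypotheses stay general because implications add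
a hypothesis and quantifiers add a variable. -/
theorem Derivable.of_isTrivial {φ : Fml P} (h : φ.IsTrivial) :
    ∀ {Γ : List Ty} {Ψ : Set (Fml P)}, WfCtx S Γ Ψ → Wf S Γ φ → Derivable S Γ Ψ φ := by
  induction h with
  | top => exact fun hΨ hφ => .topI ⟨hΨ, hφ⟩
  | and _ _ ih₁ ih₂ =>
    intro Γ Ψ hΨ hφ
    cases hφ with | and h₁ h₂ => exact .andI ⟨hΨ, .and h₁ h₂⟩ (ih₁ hΨ h₁) (ih₂ hΨ h₂)
  | imp _ ih =>
    intro Γ Ψ hΨ hφ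
    cases hφ with | imp h₁ h₂ => exact .impI ⟨hΨ, .imp h₁ h₂⟩ (ih (hΨ.insert h₁) h₂)
  | all _ ih =>
    intro Γ Ψ hΨ hφ
    cases hφ with | all h => exact .allI ⟨hΨ, .all h⟩ (ih (hΨ.wk_one _) h)

theorem Derivable.eq_refl {Γ : List Ty} {Ψ : Set (Fml P)} {t : Tm} {τ : Ty} (hΨ : WfCtx S Γ Ψ)
    (ht : HasTy Γ t τ) : Derivable S Γ Ψ (.eq τ t t) :=
  .conv ⟨hΨ, .eq ht ht⟩ ht ht (Relation.EqvGen.refl t)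

end HOL

/-! ### The assertions $\lfloor\tau\rfloor_a$: substitution, protection, replacement of equals. -/

namespace DCC
open PCF HOL

variable {P : Type u} {S : Signature P} {a : Label}

/-- The related terms are the only place where free variables enter. This computes all the
substitutions that the RHOL rules perform on postconditions. -/
theorem rel_subst (τ : Ty) (x y : Tm) (σ : ℕ → Tm) :
    (rel P a τ x y).subst σ = rel P a τ (x.subst σ) (y.subst σ) := by
  induction τ generalizing x y σ with
  | bool => rfl
  | arr τ₁ τ₂ ih₁ ih₂ =>
    simp only [rel, Fml.subst, ih₁, ih₂, Tm.subst, Tm.subst_sh_lift_lift]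
    rfl
  | prod τ₁ τ₂ ih₁ ih₂ => simp only [rel, Fml.subst, ih₁, ih₂, Tm.subst]
  | mon l τ ih =>
    simp only [rel]
    split
    · exact ih x y σ
    · rfl

theorem wf_rel {τ : Ty} {Γ : List PCF.Ty} {x y : Tm} (hx : PCF.HasTy Γ x τ.erase)
    (hy : PCF.HasTy Γ y τ.erase) : Wf S Γ (rel P a τ x y) := by
  induction τ generalizing Γ x y with
  | bool => exact .or (.and (.eq hx .tt) (.eq hy .tt)) (.and (.eq hx .ff) (.eq hy .ff))
  | arr τ₁ τ₂ ih₁ ih₂ =>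
    exact .all (.all (.imp (ih₁ (.var rfl) (.var rfl))
      (ih₂ (.app (hx.sh_two _ _) (.var rfl)) (.app (hy.sh_two _ _) (.var rfl)))))
  | prod τ₁ τ₂ ih₁ ih₂ => exact .and (ih₁ (.fst hx) (.fst hy)) (ih₂ (.snd hx) (.snd hy))
  | mon l τ ih =>
    rw [rel]
    split
    · exact ih hx hy
    · exact .top

theorem wf_rel_var (τ : Ty) (Γ : List PCF.Ty) :
    Wf S (τ.erase :: τ.erase :: Γ) (rel P a τ ♯1 ♯0) :=
  wf_rel (.var rfl) (.var rfl)

theorem Label.le_trans {a b c : Label} (h : a ≤ b) (h' : b ≤ c) : a ≤ c := by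
  cases a <;> cases b <;> cases c <;> trivial

/-- The heart of the `bind` case. The clauses of protection follow the closure of `Fml.IsTrivial`: a
hidden $T_{\ell'}$ contributes $\top$, products need both components, and functions only their
codomain. Transitivity excludes $\ell\sqsubseteq\ell'\sqsubseteq a$. -/
theorem rel_isTrivial {τ : Ty} {l : Label} (h : Protected τ l) (hl : ¬ l ≤ a) (x y : Tm) :
    (rel P a τ x y).IsTrivial := by
  induction h generalizing x y with
  | @here l l' _ hle =>
    rw [rel, if_neg fun h => hl (Label.le_trans hle h)]
    exact .top
  | mon _ ih =>
    rw [rel]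
    split
    · exact ih hl x y
    · exact .top
  | prod _ _ ih₁ ih₂ => exact .and (ih₁ hl _ _) (ih₂ hl _ _)
  | arr _ ih => exact .all (.all (.imp (ih hl _ _)))

/-- The substitution rule of HOL replaces one term at a time, so it is applied twice, each time with
one argument abstracted and the other weakened. -/
theorem derivable_rel_of_eq {Γ : List PCF.Ty} {Ψ : Set (Fml P)} {τ : Ty} {x x' y y' : Tm}
    (hΨ : WfCtx S Γ Ψ) (hx' : PCF.HasTy Γ x' τ.erase) (hy : PCF.HasTy Γ y τ.erase)
    (hy' : PCF.HasTy Γ y' τ.erase) (h : HOL.Derivable S Γ Ψ (rel P a τ x y))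
    (hxx : HOL.Derivable S Γ Ψ (.eq τ.erase x x')) (hyy : HOL.Derivable S Γ Ψ (.eq τ.erase y y')) :
    HOL.Derivable S Γ Ψ (rel P a τ x' y') := by
  have instL (t s : Tm) : (rel P a τ ♯0 (s.subst (sh 1))).inst t = rel P a τ t s := by
    rw [Fml.inst, rel_subst, Tm.subst_sh_one_scons]; rfl
  have instR (t s : Tm) : (rel P a τ (t.subst (sh 1)) ♯0).inst s = rel P a τ t s := by
    rw [Fml.inst, rel_subst, Tm.subst_sh_one_scons]; rfl
  have h₁ := HOL.Derivable.subst (s := x') ⟨hΨ, (instL x' y).symm ▸ wf_rel hx' hy⟩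
    (wf_rel (.var rfl) (hy.sh_one _)) ((instL x y).symm ▸ h) hxx
  rw [instL] at h₁
  have h₂ := HOL.Derivable.subst (s := y') ⟨hΨ, (instR x' y').symm ▸ wf_rel hx' hy'⟩
    (wf_rel (hx'.sh_one _) (.var rfl)) ((instR x' y).symm ▸ h₁) hyy
  rwa [instR] at h₂

theorem derivable_eq_fst_pair {Γ : List PCF.Ty} {Ψ : Set (Fml P)} {t s : Tm} {σ τ : PCF.Ty}
    (hΨ : WfCtx S Γ Ψ) (ht : PCF.HasTy Γ t σ) (hs : PCF.HasTy Γ s τ) :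
    HOL.Derivable S Γ Ψ (.eq σ t (.fst (.pair t s))) :=
  have h : PCF.HasTy Γ (.fst (.pair t s)) σ := .fst (.pair ht hs)
  .conv ⟨hΨ, .eq ht h⟩ ht h (.symm _ _ (.rel _ _ (.fst t s)))

theorem derivable_eq_snd_pair {Γ : List PCF.Ty} {Ψ : Set (Fml P)} {t s : Tm} {σ τ : PCF.Ty}
    (hΨ : WfCtx S Γ Ψ) (ht : PCF.HasTy Γ t σ) (hs : PCF.HasTy Γ s τ) :
    HOL.Derivable S Γ Ψ (.eq τ s (.snd (.pair t s))) :=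
  have h : PCF.HasTy Γ (.snd (.pair t s)) τ := .snd (.pair ht hs)
  .conv ⟨hΨ, .eq hs h⟩ hs h (.symm _ _ (.rel _ _ (.snd t s)))

/-- The relation at a product speaks of projections; each projection of a pair is convertible to its
component. -/
theorem derivable_rel_pair {Γ : List PCF.Ty} {Ψ : Set (Fml P)} {τ₁ τ₂ : Ty} {x y x' y' : Tm}
    (hΨ : WfCtx S Γ Ψ) (hx : PCF.HasTy Γ x τ₁.erase) (hy : PCF.HasTy Γ y τ₁.erase)
    (hx' : PCF.HasTy Γ x' τ₂.erase) (hy' : PCF.HasTy Γ y' τ₂.erase)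
    (h₁ : HOL.Derivable S Γ Ψ (rel P a τ₁ x y)) (h₂ : HOL.Derivable S Γ Ψ (rel P a τ₂ x' y')) :
    HOL.Derivable S Γ Ψ (rel P a (.prod τ₁ τ₂) (.pair x x') (.pair y y')) :=
  .andI ⟨hΨ, wf_rel (τ := .prod τ₁ τ₂) (.pair hx hx') (.pair hy hy')⟩
    (derivable_rel_of_eq hΨ (.fst (.pair hx hx')) hy (.fst (.pair hy hy')) h₁
      (derivable_eq_fst_pair hΨ hx hx') (derivable_eq_fst_pair hΨ hy hy'))
    (derivable_rel_of_eq hΨ (.snd (.pair hx hx')) hy' (.snd (.pair hy hy')) h₂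
      (derivable_eq_snd_pair hΨ hx hx') (derivable_eq_snd_pair hΨ hy hy'))

/-! ### Typing of erasures. -/

/-- `ξ` maps the variables of `Γ` to variables of `Δ` of the erased types. -/
def ErasedRen (ξ : ℕ → ℕ) (Γ : List Ty) (Δ : List PCF.Ty) : Prop :=
  ∀ (i : ℕ) (τ : Ty), Γ[i]? = some τ → Δ[ξ i]? = some τ.erase

theorem ErasedRen.liftRen {ξ : ℕ → ℕ} {Γ : List Ty} {Δ : List PCF.Ty} (h : ErasedRen ξ Γ Δ)
    (τ : Ty) : ErasedRen (liftRen ξ) (τ :: Γ) (τ.erase :: Δ) := by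
  rintro (_ | i) σ hi
  · cases hi; rfl
  · exact h i σ hi

theorem erasedRen_fst (Γ : List Ty) : ErasedRen (fun i => 2 * i + 1) Γ (eraseCtx Γ) := by
  induction Γ with
  | nil => rintro i σ hi; simp at hi
  | cons τ Γ ih =>
    rintro (_ | i) σ hi
    · cases hi; rfl
    · exact ih i σ hi

theorem erasedRen_snd (Γ : List Ty) : ErasedRen (fun i => 2 * i) Γ (eraseCtx Γ) := by
  induction Γ with
  | nil => rintro i σ hi; simp at hi
  | cons τ Γ ih =>
    rintro (_ | i) σ hi
    · cases hi; rfl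
    · exact ih i σ hi

/-- A general renaming replaces the two doublings because a single PCF binder declares one variable,
not the two of `eraseCtx`. Without `letrec` in erasures, no injectivity is required. -/
theorem HasTy.erase {Γ : List Ty} {e : Expr} {τ : Ty} (h : HasTy Γ e τ) :
    ∀ {Δ : List PCF.Ty} {ξ : ℕ → ℕ}, ErasedRen ξ Γ Δ →
      PCF.HasTy Δ (e.erase.subst fun i => ♯(ξ i)) τ.erase := by
  induction h with
  | var h => exact fun hξ => .var (hξ _ _ h)
  | lam _ ih => exact fun hξ => .lam (lift_var_comp _ ▸ ih (hξ.liftRen _))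
  | app _ _ ih₁ ih₂ => exact fun hξ => .app (ih₁ hξ) (ih₂ hξ)
  | tt => exact fun _ => .tt
  | ff => exact fun _ => .ff
  | caseBool _ _ _ ih₁ ih₂ ih₃ => exact fun hξ => .caseBool (ih₁ hξ) (ih₂ hξ) (ih₃ hξ)
  | pair _ _ ih₁ ih₂ => exact fun hξ => .pair (ih₁ hξ) (ih₂ hξ)
  | fst _ ih => exact fun hξ => .fst (ih hξ)
  | snd _ ih => exact fun hξ => .snd (ih hξ)
  | ret _ ih => exact fun hξ => ih hξ
  | bind _ _ _ ih₁ ih₂ => exact fun hξ => .app (.lam (lift_var_comp _ ▸ ih₂ (hξ.liftRen _))) (ih₁ hξ)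

theorem HasTy.erase₁ {Γ : List Ty} {e : Expr} {τ : Ty} (h : HasTy Γ e τ) :
    PCF.HasTy (eraseCtx Γ) e.erase₁ τ.erase :=
  h.erase (erasedRen_fst Γ)

theorem HasTy.erase₂ {Γ : List Ty} {e : Expr} {τ : Ty} (h : HasTy Γ e τ) :
    PCF.HasTy (eraseCtx Γ) e.erase₂ τ.erase :=
  h.erase (erasedRen_snd Γ)

/-! ### Derivations with postcondition $\top$, and the case of a protected type. -/

theorem derivable_lam_top {Γ : List PCF.Ty} {Ψ : Set (Fml P)} {t : Tm} {σ τ : PCF.Ty}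
    (hΨ : WfCtx S Γ Ψ) (ht : PCF.HasTy (σ :: Γ) t τ)
    (h : UHOL.Derivable S (σ :: Γ) (insert .top (wk 1 Ψ)) t τ .top) :
    UHOL.Derivable S Γ Ψ (.lam t) (.arr σ τ) .top :=
  .sub ⟨.lam ht, hΨ, .top⟩
    (.abs (φ' := .top) (φ := .top) ⟨.lam ht, hΨ, .all (.imp .top .top)⟩ h)
    (.of_isTrivial (.imp .top) hΨ (.imp (.all (.imp .top .top)) .top))

theorem derivable_app_top {Γ : List PCF.Ty} {Ψ : Set (Fml P)} {t s : Tm} {σ τ : PCF.Ty}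
    (hΨ : WfCtx S Γ Ψ) (ht : PCF.HasTy Γ t (.arr σ τ)) (hs : PCF.HasTy Γ s σ)
    (h₁ : UHOL.Derivable S Γ Ψ t (.arr σ τ) .top) (h₂ : UHOL.Derivable S Γ Ψ s σ .top) :
    UHOL.Derivable S Γ Ψ (.app t s) τ .top :=
  .app (φ' := .top) (φ := .top) ⟨.app ht hs, hΨ, .top⟩
    (.sub ⟨ht, hΨ, .all (.imp .top .top)⟩ h₁
      (.of_isTrivial (.imp (.all (.imp .top))) hΨ (.imp .top (.all (.imp .top .top)))))
    h₂

/-- Erased expressions satisfy the trivial specification. -/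
theorem HasTy.derivable_top {Γ : List Ty} {e : Expr} {τ : Ty} (h : HasTy Γ e τ) :
    ∀ {Δ : List PCF.Ty} {ξ : ℕ → ℕ} {Ψ : Set (Fml P)}, ErasedRen ξ Γ Δ → WfCtx S Δ Ψ →
      UHOL.Derivable S Δ Ψ (e.erase.subst fun i => ♯(ξ i)) τ.erase .top := by
  -- Isolated because `bind` erases to an applied abstraction and uses it as well.
  have lam {Γ : List Ty} {e : Expr} {τ₁ τ₂ : Ty} (h : HasTy (τ₁ :: Γ) e τ₂)
      (ih : ∀ {Δ : List PCF.Ty} {ξ : ℕ → ℕ} {Ψ : Set (Fml P)}, ErasedRen ξ (τ₁ :: Γ) Δ →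
        WfCtx S Δ Ψ → UHOL.Derivable S Δ Ψ (e.erase.subst fun i => ♯(ξ i)) τ₂.erase .top)
      {Δ : List PCF.Ty} {ξ : ℕ → ℕ} {Ψ : Set (Fml P)} (hξ : ErasedRen ξ Γ Δ) (hΨ : WfCtx S Δ Ψ) :
      UHOL.Derivable S Δ Ψ ((Tm.lam e.erase).subst fun i => ♯(ξ i)) (.arr τ₁.erase τ₂.erase)
        .top := by
    rw [Tm.subst, lift_var_comp]
    exact derivable_lam_top hΨ (h.erase (hξ.liftRen _))
      (ih (hξ.liftRen _) ((hΨ.wk_one _).insert .top))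
  have top {Γ : List PCF.Ty} {Ψ : Set (Fml P)} (hΨ : WfCtx S Γ Ψ) :
      HOL.Derivable S Γ Ψ .top := .topI ⟨hΨ, .top⟩
  induction h with
  | var h => exact fun hξ hΨ => .var ⟨.var (hξ _ _ h), hΨ, .top⟩ (top hΨ)
  | lam h ih => exact fun hξ hΨ => lam h ih hξ hΨ
  | app h₁ h₂ ih₁ ih₂ =>
    exact fun hξ hΨ => derivable_app_top hΨ (h₁.erase hξ) (h₂.erase hξ) (ih₁ hξ hΨ) (ih₂ hξ hΨ)
  | tt => exact fun _ hΨ => .tt ⟨.tt, hΨ, .top⟩ (top hΨ)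
  | ff => exact fun _ hΨ => .ff ⟨.ff, hΨ, .top⟩ (top hΨ)
  | caseBool h₁ h₂ h₃ _ ih₂ ih₃ =>
    intro Δ ξ Ψ hξ hΨ
    exact .boolcase ⟨.caseBool (h₁.erase hξ) (h₂.erase hξ) (h₃.erase hξ), hΨ, .top⟩ (h₁.erase hξ)
      (ih₂ hξ (hΨ.insert (.eq (h₁.erase hξ) .tt))) (ih₃ hξ (hΨ.insert (.eq (h₁.erase hξ) .ff)))
  | pair h₁ h₂ ih₁ ih₂ =>
    exact fun hξ hΨ => .pair ⟨.pair (h₁.erase hξ) (h₂.erase hξ), hΨ, .top⟩ (ih₁ hξ hΨ) (ih₂ hξ hΨ)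
      (.of_isTrivial (.all (.all (.imp (.imp .top)))) hΨ
        (.all (.all (.imp .top (.imp .top .top)))))
  | fst h ih => exact fun hξ hΨ => .fst ⟨.fst (h.erase hξ), hΨ, .top⟩ (ih hξ hΨ)
  | snd h ih => exact fun hξ hΨ => .snd ⟨.snd (h.erase hξ), hΨ, .top⟩ (ih hξ hΨ)
  | ret _ ih => exact fun hξ hΨ => ih hξ hΨ
  | bind h₁ h₂ _ ih₁ ih₂ =>
    exact fun hξ hΨ => derivable_app_top hΨ
      (.lam (lift_var_comp _ ▸ h₂.erase (hξ.liftRen _))) (h₁.erase hξ) (lam h₂ ih₂ hξ hΨ) (ih₁ hξ hΨ)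

/-- Subsumption needs some derivation for the given pair of terms to start from. The unary
derivation of $\top$ for the left term, embedded by `uholL`, provides it, and the protected
assertion then follows for free. -/
theorem derivable_of_protected {Γ : List Ty} {e : Expr} {τ : Ty} {l : Label} {Ψ : Set (Fml P)}
    (h : HasTy Γ e τ) (hp : Protected τ l) (hl : ¬ l ≤ a) (hΨ : WfCtx S (eraseCtx Γ) Ψ) :
    RHOL.Derivable S (eraseCtx Γ) Ψ e.erase₁ τ.erase e.erase₂ τ.erase (rel P a τ ♯1 ♯0) := by
  refine .sub (φ' := .top) ⟨h.erase₁, h.erase₂, hΨ, wf_rel_var _ _⟩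
    (.uholL ⟨h.erase₁, h.erase₂, hΨ, .top⟩ (h.derivable_top (erasedRen_fst Γ) hΨ)) ?_
  rw [Fml.inst₂, Fml.inst₂, rel_subst]
  exact .of_isTrivial (.imp (rel_isTrivial hp hl _ _)) hΨ (.imp .top (wf_rel h.erase₁ h.erase₂))

/-! ### Relational rules for the constructs, and soundness of the embedding. -/

theorem rel_mem_relCtx {Γ : List Ty} {i : ℕ} {τ : Ty} (h : Γ[i]? = some τ) :
    rel P a τ ♯(2 * i + 1) ♯(2 * i) ∈ relCtx P a Γ := by
  induction Γ generalizing i with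
  | nil => simp at h
  | cons σ Γ ih =>
    cases i with
    | zero => cases h; exact .inl rfl
    | succ i => exact .inr ⟨_, ih h, rel_subst _ _ _ _⟩

theorem wfCtx_relCtx (Γ : List Ty) : WfCtx S (eraseCtx Γ) (relCtx P a Γ) := by
  induction Γ with
  | nil => exact fun _ h => h.elim
  | cons τ Γ ih => exact (ih.wk_two _ _).insert (wf_rel_var _ _)

theorem relCtx_cons_subset {Γ : List Ty} {Ψ : Set (Fml P)} (h : relCtx P a Γ ⊆ Ψ) (τ : Ty) :
    relCtx P a (τ :: Γ) ⊆ insert (rel P a τ ♯1 ♯0) (wk 2 Ψ) :=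
  Set.insert_subset_insert (Set.image_mono h)

/-- The premise of the RHOL rule `abs` declares two variables where the body has one. Index $i+1$ is
sent to $2i+2$ by the lifted doubling and then to $2i+3=2(i+1)+1$ by the shift, while $0$ is sent to
$1$: this is the doubling for the extended context. -/
theorem Expr.erase₁_under_binder (e : Expr) :
    (e.erase.subst (lift fun i => ♯(2 * i + 1))).subst (♯1 ∷ sh 2) = e.erase₁ := by
  rw [Tm.subst_subst, Expr.erase₁]
  congr 1
  funext i
  cases i <;> rfl

theorem Expr.erase₂_under_binder (e : Expr) :
    (e.erase.subst (lift fun i => ♯(2 * i))).subst (♯0 ∷ sh 2) = e.erase₂ := by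
  rw [Tm.subst_subst, Expr.erase₂]
  congr 1
  funext i
  cases i <;> rfl

theorem arrSpec_rel (τ₁ τ₂ : Ty) :
    RHOL.arrSpec τ₁.erase τ₁.erase (rel P a τ₁ ♯1 ♯0) (rel P a τ₂ ♯1 ♯0) =
      rel P a (.arr τ₁ τ₂) ♯1 ♯0 := by
  rw [RHOL.arrSpec, rel_subst, rel_subst]
  rfl

theorem derivable_lam {Γ : List Ty} {Ψ : Set (Fml P)} {e : Expr} {τ₁ τ₂ : Ty}
    (h : HasTy (τ₁ :: Γ) e τ₂) (hΨ : WfCtx S (eraseCtx Γ) Ψ)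
    (hd : RHOL.Derivable S (eraseCtx (τ₁ :: Γ)) (insert (rel P a τ₁ ♯1 ♯0) (wk 2 Ψ))
      e.erase₁ τ₂.erase e.erase₂ τ₂.erase (rel P a τ₂ ♯1 ♯0)) :
    RHOL.Derivable S (eraseCtx Γ) Ψ (Expr.lam e).erase₁ (Ty.arr τ₁ τ₂).erase
      (Expr.lam e).erase₂ (Ty.arr τ₁ τ₂).erase (rel P a (.arr τ₁ τ₂) ♯1 ♯0) := by
  rw [← arrSpec_rel]
  refine .abs ⟨(HasTy.lam h).erase₁, (HasTy.lam h).erase₂, hΨ, ?_⟩ ?_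
  · rw [arrSpec_rel]
    exact wf_rel_var (.arr τ₁ τ₂) _
  · rw [Expr.erase₁_under_binder, Expr.erase₂_under_binder]
    exact hd

theorem derivable_app {Γ : List PCF.Ty} {Ψ : Set (Fml P)} {t₁ t₂ s₁ s₂ : Tm} {τ₁ τ₂ : Ty}
    (hΨ : WfCtx S Γ Ψ) (ht₁ : PCF.HasTy Γ t₁ (Ty.arr τ₁ τ₂).erase)
    (ht₂ : PCF.HasTy Γ t₂ (Ty.arr τ₁ τ₂).erase) (hs₁ : PCF.HasTy Γ s₁ τ₁.erase)
    (hs₂ : PCF.HasTy Γ s₂ τ₁.erase)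
    (h : RHOL.Derivable S Γ Ψ t₁ (Ty.arr τ₁ τ₂).erase t₂ (Ty.arr τ₁ τ₂).erase
      (rel P a (.arr τ₁ τ₂) ♯1 ♯0))
    (h' : RHOL.Derivable S Γ Ψ s₁ τ₁.erase s₂ τ₁.erase (rel P a τ₁ ♯1 ♯0)) :
    RHOL.Derivable S Γ Ψ (.app t₁ s₁) τ₂.erase (.app t₂ s₂) τ₂.erase (rel P a τ₂ ♯1 ♯0) := by
  -- The postcondition mentions only the two results, so the substitution of the arguments is
  -- vacuous.
  have hφ : (rel P a τ₂ ♯1 ♯0).subst (♯0 ∷ ♯1 ∷ s₂.subst (sh 2) ∷ s₁.subst (sh 2) ∷ sh 2) =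
      rel P a τ₂ ♯1 ♯0 := by
    rw [rel_subst]; rfl
  have := RHOL.Derivable.app (φ := rel P a τ₂ ♯1 ♯0)
    ⟨.app ht₁ hs₁, .app ht₂ hs₂, hΨ, hφ.symm ▸ wf_rel_var _ _⟩ (arrSpec_rel τ₁ τ₂ ▸ h) h'
  rwa [hφ] at this

theorem derivable_rel_tt {Γ : List PCF.Ty} {Ψ : Set (Fml P)} (hΨ : WfCtx S Γ Ψ) :
    HOL.Derivable S Γ Ψ (rel P a .bool .tt .tt) :=
  .orI₁ ⟨hΨ, wf_rel (a := a) (τ := .bool) .tt .tt⟩ (.andI ⟨hΨ, .and (.eq .tt .tt) (.eq .tt .tt)⟩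
    (.eq_refl hΨ .tt) (.eq_refl hΨ .tt))

theorem derivable_rel_ff {Γ : List PCF.Ty} {Ψ : Set (Fml P)} (hΨ : WfCtx S Γ Ψ) :
    HOL.Derivable S Γ Ψ (rel P a .bool .ff .ff) :=
  .orI₂ ⟨hΨ, wf_rel (a := a) (τ := .bool) .ff .ff⟩ (.andI ⟨hΨ, .and (.eq .ff .ff) (.eq .ff .ff)⟩
    (.eq_refl hΨ .ff) (.eq_refl hΨ .ff))

theorem derivable_pair {Γ : List PCF.Ty} {Ψ : Set (Fml P)} {t₁ t₂ s₁ s₂ : Tm} {τ₁ τ₂ : Ty}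
    (hΨ : WfCtx S Γ Ψ) (ht₁ : PCF.HasTy Γ t₁ τ₁.erase) (ht₂ : PCF.HasTy Γ t₂ τ₁.erase)
    (hs₁ : PCF.HasTy Γ s₁ τ₂.erase) (hs₂ : PCF.HasTy Γ s₂ τ₂.erase)
    (h : RHOL.Derivable S Γ Ψ t₁ τ₁.erase t₂ τ₁.erase (rel P a τ₁ ♯1 ♯0))
    (h' : RHOL.Derivable S Γ Ψ s₁ τ₂.erase s₂ τ₂.erase (rel P a τ₂ ♯1 ♯0)) :
    RHOL.Derivable S Γ Ψ (.pair t₁ s₁) (Ty.prod τ₁ τ₂).erase (.pair t₂ s₂) (Ty.prod τ₁ τ₂).erase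
      (rel P a (.prod τ₁ τ₂) ♯1 ♯0) := by
  refine .pair ⟨.pair ht₁ hs₁, .pair ht₂ hs₂, hΨ, wf_rel_var (.prod τ₁ τ₂) _⟩ h h' ?_
  -- Below the four quantifiers, `♯3`, `♯2` are the first components and `♯1`, `♯0` the second ones.
  simp only [rel_subst]
  simp only [Tm.subst, scons]
  have w₁ {Γ : List PCF.Ty} :
      Wf S (τ₂.erase :: τ₂.erase :: τ₁.erase :: τ₁.erase :: Γ) (rel P a τ₁ ♯3 ♯2) :=
    wf_rel (.var rfl) (.var rfl)
  have w₂ {Γ : List PCF.Ty} :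
      Wf S (τ₂.erase :: τ₂.erase :: τ₁.erase :: τ₁.erase :: Γ) (rel P a τ₂ ♯1 ♯0) :=
    wf_rel (.var rfl) (.var rfl)
  have w₃ {Γ : List PCF.Ty} :
      Wf S (τ₂.erase :: τ₂.erase :: τ₁.erase :: τ₁.erase :: Γ)
        (rel P a (.prod τ₁ τ₂) (.pair ♯3 ♯1) (.pair ♯2 ♯0)) :=
    wf_rel (τ := .prod τ₁ τ₂) (.pair (.var rfl) (.var rfl)) (.pair (.var rfl) (.var rfl))
  have hΨ' := (((hΨ.wk_one τ₁.erase).wk_one τ₁.erase).wk_one τ₂.erase).wk_one τ₂.erase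
  refine .allI ⟨hΨ, .all (.all (.all (.all (.imp w₁ (.imp w₂ w₃)))))⟩ <|
    .allI ⟨hΨ.wk_one _, .all (.all (.all (.imp w₁ (.imp w₂ w₃))))⟩ <|
    .allI ⟨(hΨ.wk_one _).wk_one _, .all (.all (.imp w₁ (.imp w₂ w₃)))⟩ <|
    .allI ⟨((hΨ.wk_one _).wk_one _).wk_one _, .all (.imp w₁ (.imp w₂ w₃))⟩ <|
    .impI ⟨hΨ', .imp w₁ (.imp w₂ w₃)⟩ <|
    .impI ⟨hΨ'.insert w₁, .imp w₂ w₃⟩ ?_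
  have hΨ'' := (hΨ'.insert w₁).insert w₂
  exact derivable_rel_pair hΨ'' (.var rfl) (.var rfl) (.var rfl) (.var rfl)
    (.ax ⟨hΨ'', w₁⟩ (.inr (.inl rfl))) (.ax ⟨hΨ'', w₂⟩ (.inl rfl))

theorem derivable_fst {Γ : List PCF.Ty} {Ψ : Set (Fml P)} {t₁ t₂ : Tm} {τ₁ τ₂ : Ty}
    (hΨ : WfCtx S Γ Ψ) (ht₁ : PCF.HasTy Γ t₁ (Ty.prod τ₁ τ₂).erase)
    (ht₂ : PCF.HasTy Γ t₂ (Ty.prod τ₁ τ₂).erase)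
    (h : RHOL.Derivable S Γ Ψ t₁ (Ty.prod τ₁ τ₂).erase t₂ (Ty.prod τ₁ τ₂).erase
      (rel P a (.prod τ₁ τ₂) ♯1 ♯0)) :
    RHOL.Derivable S Γ Ψ (.fst t₁) τ₁.erase (.fst t₂) τ₁.erase (rel P a τ₁ ♯1 ♯0) := by
  refine .fst (τ₁ := τ₂.erase) (τ₂ := τ₂.erase) ⟨.fst ht₁, .fst ht₂, hΨ, wf_rel_var _ _⟩ ?_
  rw [rel_subst]
  refine .sub ⟨ht₁, ht₂, hΨ, wf_rel (.fst (.var rfl)) (.fst (.var rfl))⟩ h ?_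
  simp only [Fml.inst₂, rel_subst]
  have w : Wf S Γ (rel P a (.prod τ₁ τ₂) t₁ t₂) := wf_rel ht₁ ht₂
  have w₁ : Wf S Γ (rel P a τ₁ (.fst t₁) (.fst t₂)) := wf_rel (.fst ht₁) (.fst ht₂)
  exact .impI ⟨hΨ, .imp w w₁⟩ (.andE₁ ⟨hΨ.insert w, w₁⟩ (.ax ⟨hΨ.insert w, w⟩ (.inl rfl)))

theorem derivable_snd {Γ : List PCF.Ty} {Ψ : Set (Fml P)} {t₁ t₂ : Tm} {τ₁ τ₂ : Ty}
    (hΨ : WfCtx S Γ Ψ) (ht₁ : PCF.HasTy Γ t₁ (Ty.prod τ₁ τ₂).erase)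
    (ht₂ : PCF.HasTy Γ t₂ (Ty.prod τ₁ τ₂).erase)
    (h : RHOL.Derivable S Γ Ψ t₁ (Ty.prod τ₁ τ₂).erase t₂ (Ty.prod τ₁ τ₂).erase
      (rel P a (.prod τ₁ τ₂) ♯1 ♯0)) :
    RHOL.Derivable S Γ Ψ (.snd t₁) τ₂.erase (.snd t₂) τ₂.erase (rel P a τ₂ ♯1 ♯0) := by
  refine .snd (σ₁ := τ₁.erase) (σ₂ := τ₁.erase) ⟨.snd ht₁, .snd ht₂, hΨ, wf_rel_var _ _⟩ ?_
  rw [rel_subst]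
  refine .sub ⟨ht₁, ht₂, hΨ, wf_rel (.snd (.var rfl)) (.snd (.var rfl))⟩ h ?_
  simp only [Fml.inst₂, rel_subst]
  have w : Wf S Γ (rel P a (.prod τ₁ τ₂) t₁ t₂) := wf_rel ht₁ ht₂
  have w₂ : Wf S Γ (rel P a τ₂ (.snd t₁) (.snd t₂)) := wf_rel (.snd ht₁) (.snd ht₂)
  exact .impI ⟨hΨ, .imp w w₂⟩ (.andE₂ ⟨hΨ.insert w, w₂⟩ (.ax ⟨hΨ.insert w, w⟩ (.inl rfl)))

/-- Soundness of the embedding, for any extension `Ψ` of `⌊Γ⌋_a`. -/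
theorem HasTy.derivable_rel (a : Label) {Γ : List Ty} {e : Expr} {τ : Ty} (h : HasTy Γ e τ) :
    ∀ {Ψ : Set (Fml P)}, WfCtx S (eraseCtx Γ) Ψ → relCtx P a Γ ⊆ Ψ →
      RHOL.Derivable S (eraseCtx Γ) Ψ e.erase₁ τ.erase e.erase₂ τ.erase (rel P a τ ♯1 ♯0) := by
  -- The hypotheses `Ψ` stay arbitrary because the branches of a case analysis add equations about
  -- the scrutinees, which do not belong to $\lfloor\Gamma\rfloor_a$.
  induction h with
  | @var Γ i τ h =>
    intro Ψ hΨ hs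
    have ht := HasTy.var h
    refine .var ⟨ht.erase₁, ht.erase₂, hΨ, wf_rel_var _ _⟩ ?_
    rw [Fml.inst₂, rel_subst]
    exact .ax ⟨hΨ, wf_rel ht.erase₁ ht.erase₂⟩ (hs (rel_mem_relCtx h))
  | lam h ih =>
    exact fun hΨ hs => derivable_lam h hΨ
      (ih ((hΨ.wk_two _ _).insert (wf_rel_var _ _)) (relCtx_cons_subset hs _))
  | app h₁ h₂ ih₁ ih₂ =>
    exact fun hΨ hs => derivable_app hΨ h₁.erase₁ h₁.erase₂ h₂.erase₁ h₂.erase₂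
      (ih₁ hΨ hs) (ih₂ hΨ hs)
  | tt => exact fun hΨ _ => .tt ⟨.tt, .tt, hΨ, wf_rel_var .bool _⟩ (derivable_rel_tt (a := a) hΨ)
  | ff => exact fun hΨ _ => .ff ⟨.ff, .ff, hΨ, wf_rel_var .bool _⟩ (derivable_rel_ff (a := a) hΨ)
  | caseBool h₁ h₂ h₃ ih₁ ih₂ ih₃ =>
    intro Ψ hΨ hs
    have ht := HasTy.caseBool h₁ h₂ h₃
    refine .boolcase ⟨ht.erase₁, ht.erase₂, hΨ, wf_rel_var _ _⟩ (ih₁ hΨ hs)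
      (ih₂ ((hΨ.insert (.eq h₁.erase₁ .tt)).insert (.eq h₁.erase₂ .tt)) ?_)
      (ih₃ ((hΨ.insert (.eq h₁.erase₁ .ff)).insert (.eq h₁.erase₂ .ff)) ?_)
    all_goals exact hs.trans ((Set.subset_insert _ _).trans (Set.subset_insert _ _))
  | pair h₁ h₂ ih₁ ih₂ =>
    exact fun hΨ hs => derivable_pair hΨ h₁.erase₁ h₁.erase₂ h₂.erase₁ h₂.erase₂
      (ih₁ hΨ hs) (ih₂ hΨ hs)
  | fst h ih => exact fun hΨ hs => derivable_fst hΨ h.erase₁ h.erase₂ (ih hΨ hs)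
  | snd h ih => exact fun hΨ hs => derivable_snd hΨ h.erase₁ h.erase₂ (ih hΨ hs)
  | @ret Γ l e τ h ih =>
    intro Ψ hΨ hs
    by_cases hl : l ≤ a
    · rw [rel, if_pos hl]
      exact ih hΨ hs
    -- By reflexivity of the order, $T_\ell(\tau)$ is protected at $\ell$ itself.
    · exact derivable_of_protected h.ret (.here (l := l) (by cases l <;> trivial)) hl hΨ
  | @bind Γ l e₁ e₂ τ₁ τ₂ h₁ h₂ hp ih₁ ih₂ =>
    intro Ψ hΨ hs
    by_cases hl : l ≤ a
    · have hd := ih₁ hΨ hs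
      -- The observer sees through $T_\ell$, so what is known of the two erasures of `e₁` is exactly
      -- what the abstraction requires of its argument.
      rw [rel, if_pos hl] at hd
      exact derivable_app (t₁ := (Expr.lam e₂).erase₁) (t₂ := (Expr.lam e₂).erase₂) hΨ
        h₂.lam.erase₁ h₂.lam.erase₂ h₁.erase₁ h₁.erase₂
        (derivable_lam h₂ hΨ
          (ih₂ ((hΨ.wk_two _ _).insert (wf_rel_var _ _)) (relCtx_cons_subset hs _))) hd
    · exact derivable_of_protected (h₁.bind h₂ hp) hp hl hΨ

end DCC

namespace DCC
open PCF

/-! ### Uniqueness of denotations -/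

/-- Weak head reduction of terms without recursion, naturals and lists. -/
inductive HeadStep : Tm → Tm → Prop
  | beta (t s : Tm) : HeadStep (.app (.lam t) s) (t.subst (s ∷ Tm.var))
  | fst (t s : Tm) : HeadStep (.fst (.pair t s)) t
  | snd (t s : Tm) : HeadStep (.snd (.pair t s)) s
  | caseTt (s r : Tm) : HeadStep (.caseBool .tt s r) s
  | caseFf (s r : Tm) : HeadStep (.caseBool .ff s r) r
  | app {t t' : Tm} (s : Tm) : HeadStep t t' → HeadStep (.app t s) (.app t' s)
  | congFst {t t' : Tm} : HeadStep t t' → HeadStep (.fst t) (.fst t')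
  | congSnd {t t' : Tm} : HeadStep t t' → HeadStep (.snd t) (.snd t')
  | caseBool {t t' : Tm} (s r : Tm) : HeadStep t t' → HeadStep (.caseBool t s r) (.caseBool t' s r)

/-- Abstractions, pairs and the boolean constants have no head step, so a contraction never competes
with a congruence rule. -/
theorem HeadStep.rightUnique : Relator.RightUnique HeadStep := by
  intro t s r h
  induction h generalizing r with
  | beta => rintro (_ | _ | _ | _ | _ | ⟨_, ⟨⟩⟩); rfl
  | fst => rintro (_ | _ | _ | _ | _ | _ | ⟨⟨⟩⟩); rfl
  | snd => rintro (_ | _ | _ | _ | _ | _ | _ | ⟨⟨⟩⟩); rfl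
  | caseTt => intro h; cases h with | caseTt => rfl | caseBool _ _ h => cases h
  | caseFf => intro h; cases h with | caseFf => rfl | caseBool _ _ h => cases h
  | app _ h ih => intro h'; cases h' with | beta => cases h | app _ h' => rw [ih h']
  | congFst h ih => intro h'; cases h' with | fst => cases h | congFst h' => rw [ih h']
  | congSnd h ih => intro h'; cases h' with | snd => cases h | congSnd h' => rw [ih h']
  | caseBool _ _ h ih =>
    intro h'
    cases h' with
    | caseTt => cases h
    | caseFf => cases h
    | caseBool _ _ h' => rw [ih h']

/-- The term `tt` or `ff`. -/
def boolTm (b : Bool) : Tm := if b then .tt else .ff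

/-- The term `t` realizes the element `v` of the carrier of `τ`. -/
def Realizes : (τ : Ty) → τ.carrier → Tm → Prop
  | .bool, b, t => Relation.ReflTransGen HeadStep t (boolTm b)
  | .arr τ₁ τ₂, f, t =>
      ∀ (v : τ₁.carrier) (s : Tm), Realizes τ₁ v s → Realizes τ₂ (f v) (.app t s)
  | .prod τ₁ τ₂, p, t => Realizes τ₁ p.1 (.fst t) ∧ Realizes τ₂ p.2 (.snd t)
  | .mon _ τ, v, t => Realizes τ v t

/-- Closure under head expansion: application and projections, through which `Realizes` tests a
term, preserve head steps. -/
theorem Realizes.of_headStep {τ : Ty} {v : τ.carrier} {t t' : Tm} (h : HeadStep t t')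
    (ht : Realizes τ v t') : Realizes τ v t := by
  induction τ generalizing t t' with
  | bool => exact .head h ht
  | arr _ _ _ ih => exact fun w s hs => ih (.app s h) (ht w s hs)
  | prod _ _ ih₁ ih₂ => exact ⟨ih₁ (.congFst h) ht.1, ih₂ (.congSnd h) ht.2⟩
  | mon _ _ ih => exact ih h ht

theorem Realizes.of_reflTransGen {τ : Ty} {v : τ.carrier} {t t' : Tm}
    (h : Relation.ReflTransGen HeadStep t t') (ht : Realizes τ v t') : Realizes τ v t := by
  induction h using Relation.ReflTransGen.head_induction_on with
  | refl => exact ht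
  | head h _ ih => exact ih.of_headStep h

theorem reflTransGen_caseBool {t t' : Tm} (h : Relation.ReflTransGen HeadStep t t') (s r : Tm) :
    Relation.ReflTransGen HeadStep (.caseBool t s r) (.caseBool t' s r) :=
  h.lift (fun t => Tm.caseBool t s r) fun _ _ h => .caseBool s r h

/-- The terms `σ i` realize the values of the valuation `ρ`. -/
def RealizesEnv (ρ : List (Σ τ : Ty, τ.carrier)) (σ : ℕ → Tm) : Prop :=
  ∀ (i : ℕ) (τ : Ty) (v : τ.carrier), ρ[i]? = some ⟨τ, v⟩ → Realizes τ v (σ i)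

theorem RealizesEnv.cons {ρ : List (Σ τ : Ty, τ.carrier)} {σ : ℕ → Tm} (h : RealizesEnv ρ σ)
    {τ : Ty} {v : τ.carrier} {t : Tm} (ht : Realizes τ v t) :
    RealizesEnv (⟨τ, v⟩ :: ρ) (t ∷ σ) := by
  rintro (_ | i) τ' v' hi
  · cases hi; exact ht
  · exact h i τ' v' hi

/-- An expression that denotes `v` has an erasure that realizes `v`. -/
theorem Den.realizes {ρ : List (Σ τ : Ty, τ.carrier)} {e : Expr} {τ : Ty} {v : τ.carrier}
    (h : Den ρ e τ v) : ∀ {σ : ℕ → Tm}, RealizesEnv ρ σ → Realizes τ v (e.erase.subst σ) := by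
  induction h with
  | var h => exact fun hσ => hσ _ _ _ h
  | lam f _ ih =>
    intro σ hσ v s hs
    -- The abstraction applied to a realizer is a β-redex; by head expansion, its contractum may be
    -- considered instead.
    refine Realizes.of_headStep (.beta _ s) ?_
    rw [Tm.subst_lift_scons]
    exact ih v (hσ.cons hs)
  | app f v _ _ ih₁ ih₂ => exact fun hσ => ih₁ hσ v _ (ih₂ hσ)
  | tt => exact fun _ => .refl
  | ff => exact fun _ => .refl
  | caseBool b _ _ _ _ _ ih ih₁ ih₂ =>
    intro σ hσ
    -- The scrutinee head-reduces to a boolean constant, and this lifts to the whole case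
    -- expression.
    refine Realizes.of_reflTransGen (reflTransGen_caseBool (ih hσ) _ _) ?_
    cases b
    · exact (ih₂ hσ).of_headStep (.caseFf _ _)
    · exact (ih₁ hσ).of_headStep (.caseTt _ _)
  | pair _ _ _ _ ih₁ ih₂ =>
    exact fun hσ => ⟨(ih₁ hσ).of_headStep (.fst _ _), (ih₂ hσ).of_headStep (.snd _ _)⟩
  | fst _ _ ih => exact fun hσ => (ih hσ).1
  | snd _ _ ih => exact fun hσ => (ih hσ).2
  | ret _ _ ih => exact fun hσ => ih hσ
  | bind _ _ _ _ ih₁ ih₂ =>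
    intro σ hσ
    refine Realizes.of_headStep (.beta _ _) ?_
    rw [Tm.subst_lift_scons]
    exact ih₂ (hσ.cons (ih₁ hσ))

theorem reflTransGen_boolTm {b : Bool} {t : Tm} (h : Relation.ReflTransGen HeadStep (boolTm b) t) :
    t = boolTm b := by
  cases h.cases_head with
  | inl h => exact h.symm
  | inr h => obtain ⟨_, h, _⟩ := h; cases b <;> cases h

theorem boolTm_injective : Function.Injective boolTm := by
  intro b c h
  cases b <;> cases c <;> first | rfl | cases h

/-- The erasure of `e` does not depend on how `Den` was derived. It head-reduces to both constants,
so by determinism one of them reduces to the other; as constants are irreducible, they coincide. -/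
theorem Den.bool_unique {l : Label} {e : Expr} {b c : Bool} (hb : Den [] e (.mon l .bool) b)
    (hc : Den [] e (.mon l .bool) c) : b = c := by
  have henv : RealizesEnv [] Tm.var := fun i _ _ h => by simp at h
  obtain h | h := Relation.ReflTransGen.total_of_right_unique HeadStep.rightUnique
    (hb.realizes henv) (hc.realizes henv)
  · exact boolTm_injective (reflTransGen_boolTm h).symm
  · exact boolTm_injective (reflTransGen_boolTm h)

/-! ### Denotations of substitution instances -/

theorem Den.rename {ρ : List (Σ τ : Ty, τ.carrier)} {e : Expr} {τ : Ty} {v : τ.carrier}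
    (h : Den ρ e τ v) : ∀ {ρ' : List (Σ τ : Ty, τ.carrier)} {ξ : ℕ → ℕ},
      (∀ i w, ρ[i]? = some w → ρ'[ξ i]? = some w) → Den ρ' (e.rename ξ) τ v := by
  have up {ρ ρ' : List (Σ τ : Ty, τ.carrier)} {ξ : ℕ → ℕ}
      (h : ∀ i w, ρ[i]? = some w → ρ'[ξ i]? = some w) (u : Σ τ : Ty, τ.carrier) :
      ∀ i w, (u :: ρ)[i]? = some w → (u :: ρ')[liftRen ξ i]? = some w := by
    rintro (_ | i) w hi
    · exact hi
    · exact h i w hi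
  induction h with
  | var h => exact fun hξ => .var (hξ _ _ h)
  | lam f _ ih => exact fun hξ => .lam f fun v => ih v (up hξ _)
  | app f v _ _ ih₁ ih₂ => exact fun hξ => .app f v (ih₁ hξ) (ih₂ hξ)
  | tt => exact fun _ => .tt
  | ff => exact fun _ => .ff
  | caseBool b _ _ _ _ _ ih₁ ih₂ ih₃ => exact fun hξ => .caseBool b _ _ (ih₁ hξ) (ih₂ hξ) (ih₃ hξ)
  | pair _ _ _ _ ih₁ ih₂ => exact fun hξ => .pair _ _ (ih₁ hξ) (ih₂ hξ)
  | fst p _ ih => exact fun hξ => .fst p (ih hξ)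
  | snd p _ ih => exact fun hξ => .snd p (ih hξ)
  | ret _ _ ih => exact fun hξ => .ret _ (ih hξ)
  | bind v _ _ _ ih₁ ih₂ => exact fun hξ => .bind v _ (ih₁ hξ) (ih₂ (up hξ _))

theorem Den.subst {ρ : List (Σ τ : Ty, τ.carrier)} {e : Expr} {τ : Ty} {v : τ.carrier}
    (h : Den ρ e τ v) : ∀ {ρ' : List (Σ τ : Ty, τ.carrier)} {σ : ℕ → Expr},
      (∀ i w, ρ[i]? = some w → Den ρ' (σ i) w.1 w.2) → Den ρ' (e.subst σ) τ v := by
  have up {ρ ρ' : List (Σ τ : Ty, τ.carrier)} {σ : ℕ → Expr}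
      (h : ∀ i w, ρ[i]? = some w → Den ρ' (σ i) w.1 w.2) (u : Σ τ : Ty, τ.carrier) :
      ∀ i w, (u :: ρ)[i]? = some w → Den (u :: ρ') (liftE σ i) w.1 w.2 := by
    rintro (_ | i) w hi
    · cases hi; exact .var rfl
    · exact (h i w hi).rename fun _ _ h => h
  induction h with
  | var h => exact fun hσ => hσ _ _ h
  | lam f _ ih => exact fun hσ => .lam f fun v => ih v (up hσ _)
  | app f v _ _ ih₁ ih₂ => exact fun hσ => .app f v (ih₁ hσ) (ih₂ hσ)
  | tt => exact fun _ => .tt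
  | ff => exact fun _ => .ff
  | caseBool b _ _ _ _ _ ih₁ ih₂ ih₃ => exact fun hσ => .caseBool b _ _ (ih₁ hσ) (ih₂ hσ) (ih₃ hσ)
  | pair _ _ _ _ ih₁ ih₂ => exact fun hσ => .pair _ _ (ih₁ hσ) (ih₂ hσ)
  | fst p _ ih => exact fun hσ => .fst p (ih hσ)
  | snd p _ ih => exact fun hσ => .snd p (ih hσ)
  | ret _ _ ih => exact fun hσ => .ret _ (ih hσ)
  | bind v _ _ _ ih₁ ih₂ => exact fun hσ => .bind v _ (ih₁ hσ) (ih₂ (up hσ _))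

theorem Den.inst {e e' : Expr} {τ τ' : Ty} {v : τ.carrier} {w : τ'.carrier}
    (h : Den [⟨τ', w⟩] e τ v) (h' : Den [] e' τ' w) : Den [] (e.inst e') τ v := by
  refine h.subst ?_
  rintro (_ | i) u hi
  · cases hi; exact h'
  · simp at hi

/-! ### The logical relation of noninterference -/

/-- Indistinguishability at observer level `a`: the interpretation of `⌊τ⌋_a` in the model. -/
def Indist (a : Label) : (τ : Ty) → τ.carrier → τ.carrier → Prop
  | .bool, b, c => b = c
  | .arr τ₁ τ₂, f, g => ∀ v w : τ₁.carrier, Indist a τ₁ v w → Indist a τ₂ (f v) (g w)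
  | .prod τ₁ τ₂, p, q => Indist a τ₁ p.1 q.1 ∧ Indist a τ₂ p.2 q.2
  | .mon l τ, v, w => l ≤ a → Indist a τ v w

/-- The counterpart in the model of `rel_isTrivial`. -/
theorem Indist.of_protected {a l : Label} {τ : Ty} (h : Protected τ l) (hl : ¬ l ≤ a)
    (v w : τ.carrier) : Indist a τ v w := by
  induction h with
  | here h => exact fun h' => absurd (Label.le_trans h h') hl
  | mon _ ih => exact fun _ => ih hl v w
  | prod _ _ ih₁ ih₂ => exact ⟨ih₁ hl _ _, ih₂ hl _ _⟩
  | arr _ ih => exact fun _ _ _ => ih hl _ _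

/-- Valuations of the variables of a context. -/
def Env : List Ty → Type
  | [] => Unit
  | τ :: Γ => τ.carrier × Env Γ

def Env.toList : {Γ : List Ty} → Env Γ → List (Σ τ : Ty, τ.carrier)
  | [], _ => []
  | τ :: _, ρ => ⟨τ, ρ.1⟩ :: ρ.2.toList

def IndistEnv (a : Label) : (Γ : List Ty) → Env Γ → Env Γ → Prop
  | [], _, _ => True
  | τ :: Γ, ρ, ρ' => Indist a τ ρ.1 ρ'.1 ∧ IndistEnv a Γ ρ.2 ρ'.2

theorem exists_lookup {Γ : List Ty} {i : ℕ} {τ : Ty} (h : Γ[i]? = some τ) :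
    ∃ F : Env Γ → τ.carrier, (∀ ρ : Env Γ, ρ.toList[i]? = some ⟨τ, F ρ⟩) ∧
      ∀ a ρ ρ', IndistEnv a Γ ρ ρ' → Indist a τ (F ρ) (F ρ') := by
  induction Γ generalizing i with
  | nil => simp at h
  | cons σ Γ ih =>
    cases i with
    | zero => cases h; exact ⟨fun ρ => ρ.1, fun _ => rfl, fun _ _ _ h => h.1⟩
    | succ i =>
      obtain ⟨F, hF, hF'⟩ := ih h
      exact ⟨fun ρ => F ρ.2, fun ρ => hF ρ.2, fun a ρ ρ' h => hF' a _ _ h.2⟩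

/-- Well-typed expressions denote functions of their valuations that preserve
indistinguishability. -/
theorem HasTy.exists_den {Γ : List Ty} {e : Expr} {τ : Ty} (h : HasTy Γ e τ) :
    ∃ F : Env Γ → τ.carrier, (∀ ρ : Env Γ, Den ρ.toList e τ (F ρ)) ∧
      ∀ a ρ ρ', IndistEnv a Γ ρ ρ' → Indist a τ (F ρ) (F ρ') := by
  -- The function `F` is chosen before the observer level, so one denotation serves all observers.
  induction h with
  | var h =>
    obtain ⟨F, hF, hF'⟩ := exists_lookup h
    exact ⟨F, fun ρ => .var (hF ρ), hF'⟩
  | lam _ ih =>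
    obtain ⟨F, hF, hF'⟩ := ih
    exact ⟨fun ρ v => F (v, ρ), fun ρ => .lam _ fun v => hF (v, ρ),
      fun a ρ ρ' h v w hvw => hF' a (v, ρ) (w, ρ') ⟨hvw, h⟩⟩
  | app _ _ ih₁ ih₂ =>
    obtain ⟨F, hF, hF'⟩ := ih₁
    obtain ⟨G, hG, hG'⟩ := ih₂
    exact ⟨fun ρ => F ρ (G ρ), fun ρ => .app _ _ (hF ρ) (hG ρ),
      fun a ρ ρ' h => hF' a ρ ρ' h _ _ (hG' a ρ ρ' h)⟩
  | tt => exact ⟨fun _ => true, fun _ => .tt, fun _ _ _ _ => rfl⟩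
  | ff => exact ⟨fun _ => false, fun _ => .ff, fun _ _ _ _ => rfl⟩
  | caseBool _ _ _ ih₁ ih₂ ih₃ =>
    obtain ⟨B, hB, hB'⟩ := ih₁
    obtain ⟨F, hF, hF'⟩ := ih₂
    obtain ⟨G, hG, hG'⟩ := ih₃
    -- The ascription exposes the carrier of `bool` as `Bool`, which the conditional needs.
    refine ⟨fun ρ => if (show Bool from B ρ) then F ρ else G ρ,
      fun ρ => .caseBool _ _ _ (hB ρ) (hF ρ) (hG ρ), fun a ρ ρ' h => ?_⟩
    have hb : B ρ = B ρ' := hB' a ρ ρ' h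
    dsimp only
    rw [hb]
    split
    · exact hF' a ρ ρ' h
    · exact hG' a ρ ρ' h
  | pair _ _ ih₁ ih₂ =>
    obtain ⟨F, hF, hF'⟩ := ih₁
    obtain ⟨G, hG, hG'⟩ := ih₂
    exact ⟨fun ρ => (F ρ, G ρ), fun ρ => .pair _ _ (hF ρ) (hG ρ),
      fun a ρ ρ' h => ⟨hF' a ρ ρ' h, hG' a ρ ρ' h⟩⟩
  | fst _ ih =>
    obtain ⟨F, hF, hF'⟩ := ih
    exact ⟨fun ρ => (F ρ).1, fun ρ => .fst _ (hF ρ), fun a ρ ρ' h => (hF' a ρ ρ' h).1⟩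
  | snd _ ih =>
    obtain ⟨F, hF, hF'⟩ := ih
    exact ⟨fun ρ => (F ρ).2, fun ρ => .snd _ (hF ρ), fun a ρ ρ' h => (hF' a ρ ρ' h).2⟩
  | ret _ ih =>
    obtain ⟨F, hF, hF'⟩ := ih
    exact ⟨F, fun ρ => .ret _ (hF ρ), fun a ρ ρ' h _ => hF' a ρ ρ' h⟩
  | @bind _ l _ _ τ₁ _ _ _ hp ih₁ ih₂ =>
    obtain ⟨F, hF, hF'⟩ := ih₁
    obtain ⟨G, hG, hG'⟩ := ih₂
    refine ⟨fun ρ => G (F ρ, ρ), fun ρ => .bind (τ₁ := τ₁) (F ρ) _ (hF ρ) (hG (F ρ, ρ)),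
      fun a ρ ρ' h => ?_⟩
    -- If the observer sees $\ell$, the two values passed to the body are indistinguishable.
    -- Otherwise they may differ arbitrarily, but the result type is protected.
    by_cases hl : l ≤ a
    · exact hG' a (F ρ, ρ) (F ρ', ρ') ⟨hF' a ρ ρ' h hl, h⟩
    · exact .of_protected hp hl _ _

theorem Den.denotesBool {l : Label} {e : Expr} {b : Bool} (h : Den [] e (.mon l .bool) b) :
    DenotesBool l e b :=
  fun _ => ⟨fun hc => hc.bool_unique h, fun hc => hc ▸ h⟩

theorem noninterference {l l' : Label} {e e₁ e₂ : Expr} (hl : ¬ l ≤ l')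
    (h : HasTy [.mon l .bool] e (.mon l' .bool)) (h₁ : HasTy [] e₁ (.mon l .bool))
    (h₂ : HasTy [] e₂ (.mon l .bool)) :
    ∃ b : Bool, DenotesBool l' (e.inst e₁) b ∧ DenotesBool l' (e.inst e₂) b := by
  obtain ⟨F, hF, hF'⟩ := h.exists_den
  obtain ⟨F₁, hF₁, -⟩ := h₁.exists_den
  obtain ⟨F₂, hF₂, -⟩ := h₂.exists_den
  -- Observer level `l'`: the relation at the input type is vacuous since `l ≤ l'` fails, and at the
  -- output type it is equality since `l' ≤ l'`.
  have heq : F (F₁ (), ()) = F (F₂ (), ()) :=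
    hF' l' (F₁ (), ()) (F₂ (), ()) ⟨fun h => absurd h hl, trivial⟩ (by cases l' <;> trivial)
  refine ⟨F (F₁ (), ()), ((hF (F₁ (), ())).inst (hF₁ ())).denotesBool, ?_⟩
  rw [heq]
  exact ((hF (F₂ (), ())).inst (hF₂ ())).denotesBool

end DCC

theorem mainTheorem7 :
    (∀ (P : Type u) (S : HOL.Signature P) (Γ : List DCC.Ty) (e : DCC.Expr) (τ : DCC.Ty),
      DCC.HasTy Γ e τ → ∀ a : DCC.Label,
        RHOL.Derivable S (DCC.eraseCtx Γ) (DCC.relCtx P a Γ)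
          e.erase₁ τ.erase e.erase₂ τ.erase (DCC.rel P a τ ♯1 ♯0)) ∧
    (∀ (l l' : DCC.Label) (e e₁ e₂ : DCC.Expr), ¬ l ≤ l' →
      DCC.HasTy [.mon l .bool] e (.mon l' .bool) →
      DCC.HasTy [] e₁ (.mon l .bool) → DCC.HasTy [] e₂ (.mon l .bool) →
        ∃ b : Bool, DCC.DenotesBool l' (e.inst e₁) b ∧ DCC.DenotesBool l' (e.inst e₂) b) := by
  exact ⟨fun _ _ Γ _ _ h a => h.derivable_rel a (DCC.wfCtx_relCtx Γ) subset_rfl,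
    fun _ _ _ _ _ hl h h₁ h₂ => DCC.noninterference hl h h₁ h₂⟩
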